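/- Let $N=\{1,\dots,n\}$, let $u:\mathbb R^n\to\mathbb R$ be continuously differentiable with $u(\mathbf 0)\ge 0$, and let $p\ge 2$, $q\ge 1$ be integers. Let $\mathcal I\subseteq 2^N$ be either (i) a $p$-matroid intersection, i.e. the family of common independent sets of $p$ matroids on $N$; or (ii) a $p$-exchange system, i.e. a family that contains $\emptyset$, is closed under subsets, and is such that for all $S,T\in\mathcal I$ there is a map $\varphi:T\setminus S\to 2^{S\setminus T}$ with $|\varphi(v)|\le p$ for all $v\in T\setminus S$, each element of $S\setminus T$ lying in at most $p$ of the sets $\varphi(v)$, and $(S\setminus\bigcup_{v\in X}\varphi(v))\cup X\in\mathcal I$ for all $X\subseteq T\setminus S$. Let $s=\max\{|X|:X\in\mathcal I\}$ and assume $s\ge 1$. For an integer $r\ge1$ let $\Omega_r$ be the set of pairs $(\mathbf x,\mathbf y)\in\mathbb R^n\times\mathbb R^n$ such that $\mathbf x$, $\mathbf y$ and $\mathbf x-\mathbf y$ each have at most $r$ non-zero entries. For $r=1$ and $r=s$, assume that $u$ is restricted strongly concave with parameter $m_r>0$ and restricted smooth with parameter $M_r$ on $\Omega_r$, i.e. for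 all $(\mathbf x,\mathbf y)\in\Omega_r$, $$-\tfrac{m_r}{2}\|\mathbf y-\mathbf x\|_2^2\ \ge\ u(\mathbf y)-u(\mathbf x)-\langle\nabla u(\mathbf x),\mathbf y-\mathbf x\rangle\ \ge\ -\tfrac{M_r}{2}\|\mathbf y-\mathbf x\|_2^2 .$$ Put $f(X)=\max_{\mathrm{supp}(\mathbf w)\subseteq X}u(\mathbf w)$ and let $\tilde f(X)=f(\emptyset)+\sum_{x\in X}\bigl(f(\{x\})-f(\emptyset)\bigr)$ be its modular approximation. Call $T\in\mathcal I$ $q$-reachable from $S\in\mathcal I$ if, in case (i), $|T\setminus S|\le 2q$ and $|S\setminus T|\le 2pq$, and, in case (ii), $|T\setminus S|\le q$ and $|S\setminus T|\le pq-q+1$. Let $\varepsilon>0$ and $\delta>0$ with $\delta n\le\varepsilon$ (for example $\delta=\varepsilon/n$). Modular approximation with local search maximizes $\tilde f$ over $\mathcal I$ as follows: start from a feasible singleton of largest $\tilde f$-value, possibly enlarged by arbitrary elements to a larger feasible set; as long as some set $T$ that is $q$-reachable from the current solution $X$ satisfies $\tilde f(T)>(1+\delta)\tilde f(X)$, replace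 $X$ by any such $T$; when there is none, return $X$. Then: 1. For every $X\in\mathcal I$ the maximum defining $f(X)$ is attained. 2. Every execution performs at most $\ln s/\ln(1+\delta)$ iterations, and at each iteration the number of sets that are $q$-reachable from the current solution is at most $(n+1)^{2q+2pq}$ in case (i) and at most $(n+1)^{pq+1}$ in case (ii). In particular every execution stops, and some output is returned. 3. Every set $X$ that the algorithm can return is feasible, and it is a $\left(\frac{1}{p-1+1/q}\,\frac{m_1m_s}{M_1M_s}-\varepsilon\right)$-approximate solution: $$f(X)\ \ge\ \left(\frac{1}{p-1+1/q}\cdot\frac{m_1m_s}{M_1M_s}-\varepsilon\right)f(Y)\qquad\text{for all }Y\in\mathcal I,$$ in particular when $Y$ is an optimal solution. -/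

import Mathlib

open scoped BigOperators

noncomputable section

namespace SparseOpt

/-! ### Sparse optimization -/

/-- The support `supp(w) = {i | w i ≠ 0}` of a vector. -/
def supp {n : ℕ} (w : EuclideanSpace ℝ (Fin n)) : Finset (Fin n) :=
  Finset.univ.filter fun i => w i ≠ 0

/-- `Ω_s`: the pairs `(x, y)` with `‖x‖₀ ≤ s`, `‖y‖₀ ≤ s` and `‖x - y‖₀ ≤ s`. -/
def sparsePairs (n s : ℕ) : Set (EuclideanSpace ℝ (Fin n) × EuclideanSpace ℝ (Fin n)) :=
  {z | (supp z.1).card ≤ s ∧ (supp z.2).card ≤ s ∧ (supp (z.1 - z.2)).card ≤ s}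

/-- `u` is restricted strongly concave on `Ω` with parameter `m`. -/
def RestrictedStronglyConcave {n : ℕ} (u : EuclideanSpace ℝ (Fin n) → ℝ)
    (Ω : Set (EuclideanSpace ℝ (Fin n) × EuclideanSpace ℝ (Fin n))) (m : ℝ) : Prop :=
  ∀ x y, (x, y) ∈ Ω →
    u y - u x - inner ℝ (gradient u x) (y - x) ≤ -(m / 2) * ‖y - x‖ ^ 2

/-- `u` is restricted smooth on `Ω` with parameter `M`. -/
def RestrictedSmooth {n : ℕ} (u : EuclideanSpace ℝ (Fin n) → ℝ)
    (Ω : Set (EuclideanSpace ℝ (Fin n) × EuclideanSpace ℝ (Fin n))) (M : ℝ) : Prop :=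
  ∀ x y, (x, y) ∈ Ω →
    -(M / 2) * ‖y - x‖ ^ 2 ≤ u y - u x - inner ℝ (gradient u x) (y - x)

/-- The values of `u` on the vectors supported in `X`. -/
def valuesOn {n : ℕ} (u : EuclideanSpace ℝ (Fin n) → ℝ) (X : Finset (Fin n)) : Set ℝ :=
  {r | ∃ w, supp w ⊆ X ∧ u w = r}

/-- The set function `f(X) = max_{supp(w) ⊆ X} u(w)`.  (The main theorem also asserts that
the supremum is an attained maximum for every feasible `X`.) -/
def sparseValue {n : ℕ} (u : EuclideanSpace ℝ (Fin n) → ℝ) (X : Finset (Fin n)) : ℝ :=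
  sSup (valuesOn u X)

/-- The modular approximation `X ↦ f(∅) + ∑_{x ∈ X} (f({x}) - f(∅))` of `f`. -/
def modularApprox {n : ℕ} (f : Finset (Fin n) → ℝ) (X : Finset (Fin n)) : ℝ :=
  f ∅ + ∑ x ∈ X, (f {x} - f ∅)

/-! ### Constraints -/

/-- Independence systems on the ground set `Fin n`. -/
def IsIndependenceSystem {n : ℕ} (I : Set (Finset (Fin n))) : Prop :=
  ∅ ∈ I ∧ ∀ X Y : Finset (Fin n), X ⊆ Y → Y ∈ I → X ∈ I

/-- `I` is the family of common independent sets of `p` matroids on the ground set `Fin n`. -/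
def IsMatroidIntersection {n : ℕ} (p : ℕ) (I : Set (Finset (Fin n))) : Prop :=
  ∃ M : Fin p → Matroid (Fin n), (∀ i, (M i).E = Set.univ) ∧
    ∀ X : Finset (Fin n), X ∈ I ↔ ∀ i, (M i).Indep (X : Set (Fin n))

/-- `I` is a `p`-exchange system. -/
def IsExchangeSystem {n : ℕ} (p : ℕ) (I : Set (Finset (Fin n))) : Prop :=
  IsIndependenceSystem I ∧
  ∀ S ∈ I, ∀ T ∈ I, ∃ φ : Fin n → Finset (Fin n),
    (∀ v ∈ T \ S, φ v ⊆ S \ T ∧ (φ v).card ≤ p) ∧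
    (∀ v ∈ S \ T, ((T \ S).filter fun w => v ∈ φ w).card ≤ p) ∧
    (∀ X ⊆ T \ S, (S \ X.biUnion φ) ∪ X ∈ I)

/-- The two kinds of constraints considered. -/
inductive ConstraintKind : Type
  | matroidIntersection
  | exchangeSystem

/-- `I` is a `p`-matroid intersection, respectively a `p`-exchange system. -/
def ConstraintKind.Holds {n : ℕ} (κ : ConstraintKind) (p : ℕ) (I : Set (Finset (Fin n))) : Prop :=
  match κ with
  | .matroidIntersection => IsMatroidIntersection p I
  | .exchangeSystem => IsExchangeSystem p I

/-- The number of elements that a local move may insert. -/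
def ConstraintKind.maxInsert (κ : ConstraintKind) (q : ℕ) : ℕ :=
  match κ with
  | .matroidIntersection => 2 * q
  | .exchangeSystem => q

/-- The number of elements that a local move may delete. -/
def ConstraintKind.maxDelete (κ : ConstraintKind) (p q : ℕ) : ℕ :=
  match κ with
  | .matroidIntersection => 2 * p * q
  | .exchangeSystem => p * q - q + 1

/-- The feasible sets that are `q`-reachable from `S`. -/
def ConstraintKind.reachable {n : ℕ} (κ : ConstraintKind) (p q : ℕ) (I : Set (Finset (Fin n)))
    (S : Finset (Fin n)) : Set (Finset (Fin n)) :=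
  {T | T ∈ I ∧ (T \ S).card ≤ κ.maxInsert q ∧ (S \ T).card ≤ κ.maxDelete p q}

/-! ### Local search -/

/-- `LocalSearchState I nbhd g δ k X`: some execution of the local search for maximizing `g`
over `I` holds the solution `X` after `k` iterations.  The initial solution is a feasible
singleton of largest value, possibly enlarged by arbitrary elements to a feasible set; each
iteration moves to any set in the neighbourhood `nbhd X` of the current solution `X` whose value
exceeds `(1 + δ) * g X`. -/
inductive LocalSearchState {n : ℕ} (I : Set (Finset (Fin n)))
    (nbhd : Finset (Fin n) → Set (Finset (Fin n))) (g : Finset (Fin n) → ℝ) (δ : ℝ) :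
    ℕ → Finset (Fin n) → Prop
  | init (v : Fin n) (X : Finset (Fin n)) (hX : X ∈ I) (hv : v ∈ X)
      (hmax : ∀ w : Fin n, {w} ∈ I → g {w} ≤ g {v}) : LocalSearchState I nbhd g δ 0 X
  | step (k : ℕ) (X Y : Finset (Fin n)) (hX : LocalSearchState I nbhd g δ k X)
      (hY : Y ∈ nbhd X) (himp : (1 + δ) * g X < g Y) : LocalSearchState I nbhd g δ (k + 1) Y

/-- Some execution of the local search stops after `k` iterations and returns `X`: it holds `X`
after `k` iterations, and no neighbour of `X` qualifies for a move. -/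
def LocalSearchOutput {n : ℕ} (I : Set (Finset (Fin n)))
    (nbhd : Finset (Fin n) → Set (Finset (Fin n))) (g : Finset (Fin n) → ℝ) (δ : ℝ)
    (k : ℕ) (X : Finset (Fin n)) : Prop :=
  LocalSearchState I nbhd g δ k X ∧ ∀ Y ∈ nbhd X, g Y ≤ (1 + δ) * g X

end SparseOpt

end

open SparseOpt

namespace SparseOpt

/-! Only pairs `(0, w)` are needed from `Ω`. Completing the square in the concavity bound, and a
gradient step in the smoothness bound, trap `f(X) - f(∅)` between `∑_{i ∈ X} (∂ᵢu(0))²` divided by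
`2M` and by `2m`. Using level `1` for singletons and level `s` for feasible sets gives `m₁ f̃(X) ≤
Mₛ f(X)` and `mₛ f(Y) ≤ M₁ f̃(Y)`. It remains to see that local search for nonnegative modular
weights loses only the factor `p - 1 + 1/q`, up to `ε`.

Two of the `p` units of constraint are handled by perfect matchings on exchange graphs between `Y \
X` and `X \ Y`. Their union consists of alternating closed walks; windows of `q` insertions and `q +
1` deletions, averaged around a walk, cost `1 + 1/q` (`sum_le_of_closed_walk`). For matroids a
window may fail to be a legal move because of chords. But a chord closes up a shorter walk, where
the bound holds by induction, so in a minimal counterexample the partial sums form a potential that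
rules out alternating cycles inside windows. Such swaps preserve independence (`ind_of_swappable`).

The other `p - 2` units cost `1` each: through exchange prices in the remaining matroids
(`exists_prices`), or through the degree `p - 2` left in an exchange system after removing two
matchings (`exists_two_perms`). The slack `δ f̃(X)` is charged at most `n` times. The iteration
bound holds because every feasible value is at most `s` times the best singleton value. -/

/-! ### Two matchings: windows along alternating closed walks. -/

/-- `A` can be matched into `D` along `E` by a matching without alternating cycles. -/
def Swappable {α β : Type*} (E : α → β → Prop) (A : Finset α) (D : Finset β) : Prop :=
  ∃ d : α → β, (∀ a ∈ A, d a ∈ D ∧ E a (d a)) ∧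
    ∀ S ⊆ A, S.Nonempty → ∃ j ∈ S, ∀ i ∈ S, i ≠ j → ¬ E i (d j)

/-- In any subfamily, the partner of an element of largest potential `F` has no edge to another
member. Equal values of `b` would give both strict inequalities, hence injectivity. -/
theorem swappable_image {α β γ : Type*} [LinearOrder γ] [DecidableEq α] (E : α → β → Prop)
    (S : Finset ℕ) (b : ℕ → α) (c : ℕ → β) (D : Finset β) (F : ℕ → γ)
    (hE : ∀ i ∈ S, E (b i) (c i)) (hD : ∀ i ∈ S, c i ∈ D)
    (hF : ∀ i ∈ S, ∀ j ∈ S, i ≠ j → E (b i) (c j) → F j < F i) :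
    Set.InjOn b S ∧ Swappable E (S.image b) D := by
  have hinj : Set.InjOn b S := by
    intro i hi j hj hij
    by_contra hne
    have h1 := hF i hi j hj hne (hij ▸ hE j hj)
    have h2 := hF j hj i hi (Ne.symm hne) (hij ▸ hE i hi)
    exact lt_asymm h1 h2
  refine ⟨hinj, fun a => c (Function.invFunOn b S a), ?_, ?_⟩
  · intro a ha
    obtain ⟨i, hi, rfl⟩ := Finset.mem_image.1 ha
    have : Function.invFunOn b S (b i) = i := hinj.leftInvOn_invFunOn hi
    simp only [this]
    exact ⟨hD i hi, hE i hi⟩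
  · intro T hT hTne
    have hinv : ∀ a ∈ T, Function.invFunOn b S a ∈ S ∧ b (Function.invFunOn b S a) = a := by
      intro a ha
      obtain ⟨i, hi, rfl⟩ := Finset.mem_image.1 (hT ha)
      exact ⟨Function.invFunOn_mem ⟨i, hi, rfl⟩, Function.invFunOn_eq ⟨i, hi, rfl⟩⟩
    obtain ⟨j, hj, hmax⟩ := T.exists_max_image (fun a => F (Function.invFunOn b S a)) hTne
    refine ⟨j, hj, fun i hi hij hEij => ?_⟩
    have := hF _ (hinv i hi).1 _ (hinv j hj).1
      (fun h => hij (by rw [← (hinv i hi).2, h, (hinv j hj).2])) (by rwa [(hinv i hi).2])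
    exact absurd (hmax i hi) (not_le.2 this)

theorem sum_range_shift_of_periodic (L : ℕ) (f : ℕ → ℝ) (hf : ∀ t, f (t + L) = f t) (a : ℕ) :
    ∑ t ∈ Finset.range L, f (a + t) = ∑ t ∈ Finset.range L, f t := by
  induction a with
  | zero => simp
  | succ a ih =>
    rw [← ih]
    have h1 := Finset.sum_range_succ (fun t => f (a + t)) L
    have h2 := Finset.sum_range_succ' (fun t => f (a + t)) L
    rw [hf] at h1
    have h3 : ∑ t ∈ Finset.range L, f (a + 1 + t) = ∑ t ∈ Finset.range L, f (a + (t + 1)) :=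
      Finset.sum_congr rfl fun t _ => by congr 1; ring
    simp only [add_zero] at h2
    linarith

theorem sum_range_add_of_periodic (L : ℕ) (f : ℕ → ℝ) (hf : ∀ t, f (t + L) = f t) (a : ℕ) :
    ∑ t ∈ Finset.range (a + L), f t = ∑ t ∈ Finset.range a, f t + ∑ t ∈ Finset.range L, f t := by
  rw [Finset.sum_range_add, sum_range_shift_of_periodic L f hf]

theorem sum_image_le_sum {α β : Type*} [DecidableEq β] (S : Finset α) (c : α → β) (κ : β → ℝ)
    (hκ : ∀ x, 0 ≤ κ x) : ∑ x ∈ S.image c, κ x ≤ ∑ i ∈ S, κ (c i) := by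
  classical
  induction S using Finset.induction_on with
  | empty => simp
  | insert a S ha ih =>
    rw [Finset.image_insert, Finset.sum_insert ha]
    refine le_trans ?_ (add_le_add_right ih _)
    by_cases h : c a ∈ S.image c
    · rw [Finset.insert_eq_of_mem h]
      linarith [hκ (c a)]
    · rw [Finset.sum_insert h]

theorem sum_le_of_closed_walk {α β : Type*} [DecidableEq α] [DecidableEq β]
    (E₁ E₂ : α → β → Prop) (ω : α → ℝ) (κ : β → ℝ) (hκ : ∀ x, 0 ≤ κ x) (q : ℕ) (hq : 1 ≤ q)
    (H : ∀ (A : Finset α) (D : Finset β), A.card ≤ q → D.card ≤ q + 1 →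
      Swappable E₁ A D → Swappable E₂ A D → ∑ a ∈ A, ω a ≤ ∑ x ∈ D, κ x)
    (L : ℕ) : 1 ≤ L → ∀ (b : ℕ → α) (c : ℕ → β), (∀ t < L, E₂ (b t) (c t)) →
      (∀ t, t + 1 < L → E₁ (b (t + 1)) (c t)) → E₁ (b 0) (c (L - 1)) →
      ∑ t ∈ Finset.range L, ω (b t) ≤ (1 + 1 / (q : ℝ)) * ∑ t ∈ Finset.range L, κ (c t) := by
  induction L using Nat.strong_induction_on with
  | _ L ih =>
  intro hL b₀ c₀ h2 h1 h0
  have hq0 : (0 : ℝ) < q := by exact_mod_cast hq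
  set r : ℝ := 1 + 1 / (q : ℝ) with hr
  have hr1 : 1 ≤ r := by rw [hr]; have : 0 ≤ 1 / (q : ℝ) := by positivity
                         linarith
  -- Periodic extension of the walk, so that windows and chords may wrap around.
  obtain ⟨b, hb⟩ : ∃ b : ℕ → α, b = fun t => b₀ (t % L) := ⟨_, rfl⟩
  obtain ⟨c, hc⟩ : ∃ c : ℕ → β, c = fun t => c₀ (t % L) := ⟨_, rfl⟩
  have hbL : ∀ t, b (t + L) = b t := fun t => by simp [hb]
  have hcL : ∀ t, c (t + L) = c t := fun t => by simp [hc]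
  have hE2 : ∀ t, E₂ (b t) (c t) := fun t => by
    simp only [hb, hc]; exact h2 _ (Nat.mod_lt _ hL)
  have hE1 : ∀ t, E₁ (b (t + 1)) (c t) := fun t => by
    simp only [hb, hc]
    have hlt : t % L < L := Nat.mod_lt _ hL
    have hmod : (t + 1) % L = (t % L + 1) % L := by simp
    rw [hmod]
    by_cases h : t % L + 1 < L
    · rw [Nat.mod_eq_of_lt h]; exact h1 _ h
    · have h' : t % L + 1 = L := by omega
      rw [h', Nat.mod_self]
      have : t % L = L - 1 := by omega
      rw [this]; exact h0
  rw [show ∑ t ∈ Finset.range L, ω (b₀ t) = ∑ t ∈ Finset.range L, ω (b t) from by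
      rw [hb]; exact Finset.sum_congr rfl fun t ht => by
        simp only [Nat.mod_eq_of_lt (Finset.mem_range.1 ht)],
    show ∑ t ∈ Finset.range L, κ (c₀ t) = ∑ t ∈ Finset.range L, κ (c t) from by
      rw [hc]; exact Finset.sum_congr rfl fun t ht => by
        simp only [Nat.mod_eq_of_lt (Finset.mem_range.1 ht)]]
  by_contra hcon
  push Not at hcon
  -- In a counterexample the partial sums `W` gain `W L > 0` per turn.
  obtain ⟨φ, hφ⟩ : ∃ φ : ℕ → ℝ, φ = fun t => ω (b t) - r * κ (c t) := ⟨_, rfl⟩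
  obtain ⟨W, hW⟩ : ∃ W : ℕ → ℝ, W = fun m => ∑ t ∈ Finset.range m, φ t := ⟨_, rfl⟩
  have hφL : ∀ t, φ (t + L) = φ t := fun t => by simp only [hφ, hbL, hcL]
  have hWL : ∀ m, W (m + L) = W m + W L := fun m => by
    simp only [hW]; exact sum_range_add_of_periodic L φ hφL m
  have hWadd : ∀ i m, W (i + m) = W i + ∑ t ∈ Finset.range m, φ (i + t) := fun i m => by
    simp only [hW, Finset.sum_range_add]
  have hΛ : 0 < W L := by
    simp only [hW, hφ, Finset.sum_sub_distrib, ← Finset.mul_sum]; linarith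
  -- shortcuts along `E₁`
  have arc1 : ∀ i j, i ≤ j → j + 1 < i + L → E₁ (b i) (c j) → W (j + 1) ≤ W i := by
    intro i j hij hjL hE
    obtain ⟨m, rfl⟩ := Nat.exists_eq_add_of_le hij
    -- The chord closes `b i, c i, …, b j, c j` into a walk of length `j - i + 1 < L`.
    have := ih (m + 1) (by omega) (by omega) (fun t => b (i + t)) (fun t => c (i + t))
      (fun t _ => hE2 _) (fun t _ => hE1 _) (by simpa using hE)
    rw [add_assoc, hWadd i (m + 1)]
    simp only [hφ, Finset.sum_sub_distrib, ← Finset.mul_sum]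
    linarith
  -- shortcuts along `E₂`
  have arc2 : ∀ i j, j < i → i < j + L → E₂ (b i) (c j) →
      W i + ω (b i) ≤ W j + ω (b j) := by
    intro i j hij hjL hE
    obtain ⟨m, rfl⟩ := Nat.exists_eq_add_of_lt hij
    -- The shorter walk is `b i, c j, b (j + 1), …, c (i - 1)`: `b i` takes the place of `b j`.
    have := ih (m + 1) (by omega) (by omega)
      (fun t => if t = 0 then b (j + m + 1) else b (j + t)) (fun t => c (j + t))
      (fun t _ => by
        by_cases ht : t = 0
        · simpa [ht] using hE
        · simpa [ht] using hE2 (j + t))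
      (fun t _ => by simpa [add_assoc] using hE1 (j + t)) (by simpa using hE1 (j + m))
    rw [Finset.sum_range_succ'] at this
    simp only [Nat.add_eq_zero_iff, one_ne_zero, and_false, if_false, if_true] at this
    rw [add_assoc, hWadd j (m + 1)]
    simp only [hφ, Finset.sum_sub_distrib, ← Finset.mul_sum]
    rw [Finset.sum_range_succ' (fun t => ω (b (j + t)))]
    simp only [add_zero, add_assoc] at this ⊢
    linarith
  -- a segment of the walk is a legal move
  have seg : ∀ (t l : ℕ) (D : Finset β), l ≤ q → l ≤ L → D.card ≤ q + 1 →
      (∀ s ∈ Finset.Ico t (t + l), c s ∈ D ∧ c (s + 1) ∈ D) →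
      ∑ s ∈ Finset.Ico t (t + l), ω (b (s + 1)) ≤ ∑ x ∈ D, κ x := by
    intro t l D hlq hlL hDq hD
    have k1 := swappable_image E₁ (Finset.Ico t (t + l)) (fun s => b (s + 1)) c D
      -- Ties in `W` are broken by the index; chords in the opposite direction wrap around and are
      -- strict thanks to `W L > 0`.
      (fun s => toLex (W (s + 1), -(s : ℤ))) (fun i _ => hE1 i) (fun i hi => (hD i hi).1) (by
        intro i hi j hj hij hE
        rw [Finset.mem_Ico] at hi hj
        rw [Prod.Lex.toLex_lt_toLex]
        rcases lt_or_gt_of_ne hij with h | h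
        · have := arc1 (i + 1) j h (by omega) hE
          rcases this.lt_or_eq with h' | h'
          · exact Or.inl h'
          · exact Or.inr ⟨h', by simpa using h⟩
        · have := arc1 (i + 1) (j + L) (by omega) (by omega) (by rwa [hcL])
          rw [show j + L + 1 = j + 1 + L by ring, hWL] at this
          exact Or.inl (by simp only; linarith))
    have k2 := swappable_image E₂ (Finset.Ico t (t + l)) (fun s => b (s + 1))
      (fun s => c (s + 1)) D
      (fun s => toLex (-(W (s + 1) + ω (b (s + 1))), s)) (fun i _ => hE2 _)
      (fun i hi => (hD i hi).2) (by
        intro i hi j hj hij hE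
        rw [Finset.mem_Ico] at hi hj
        rw [Prod.Lex.toLex_lt_toLex]
        rcases lt_or_gt_of_ne hij with h | h
        · have := arc2 (i + 1 + L) (j + 1) (by omega) (by omega) (by rwa [hbL])
          rw [hWL, hbL] at this
          exact Or.inl (by simp only; linarith)
        · have := arc2 (i + 1) (j + 1) (by omega) (by omega) hE
          rcases this.lt_or_eq with h' | h'
          · exact Or.inl (by simp only; linarith)
          · exact Or.inr ⟨by simp only; rw [h'], h⟩)
    have := H _ D (Finset.card_image_le.trans (by simpa using hlq)) hDq k1.2 k2.2
    rwa [Finset.sum_image k1.1] at this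
  have hbsum : ∀ a, ∑ t ∈ Finset.range L, ω (b (a + t)) = ∑ t ∈ Finset.range L, ω (b t) :=
    sum_range_shift_of_periodic L (fun t => ω (b t)) fun t => by simp only [hbL]
  have hcsum : ∀ a, ∑ t ∈ Finset.range L, κ (c (a + t)) = ∑ t ∈ Finset.range L, κ (c t) :=
    sum_range_shift_of_periodic L (fun t => κ (c t)) fun t => by simp only [hcL]
  have hcnn : 0 ≤ ∑ t ∈ Finset.range L, κ (c t) := Finset.sum_nonneg fun _ _ => hκ _
  -- A walk with `L ≤ q` is a single window, and then `r ≥ 1` is enough.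
  rcases le_or_gt L q with hLq | hLq
  · have := seg 0 L ((Finset.range L).image c) hLq le_rfl
      (Finset.card_image_le.trans (by simp; omega)) (by
        intro s hs
        rw [Finset.mem_Ico] at hs
        refine ⟨Finset.mem_image_of_mem _ (Finset.mem_range.2 (by omega)), ?_⟩
        by_cases h : s + 1 < L
        · exact Finset.mem_image_of_mem _ (Finset.mem_range.2 h)
        · refine Finset.mem_image.2 ⟨0, Finset.mem_range.2 hL, ?_⟩
          have := hcL 0
          rw [show s + 1 = 0 + L by omega, this])
    have h' := sum_image_le_sum (Finset.range L) c κ hκ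
    have h3 := hbsum 1
    simp only [zero_add, Nat.Ico_zero_eq_range, add_comm 1] at this h3
    have := mul_le_mul_of_nonneg_right hr1 hcnn
    linarith
  · have key : ∀ t, ∑ s ∈ Finset.range q, ω (b (s + 1 + t)) ≤
        ∑ s ∈ Finset.range (q + 1), κ (c (s + t)) := by
      intro t
      have := seg t q ((Finset.range (q + 1)).image fun s => c (s + t)) le_rfl hLq.le
        (Finset.card_image_le.trans (by simp)) (by
          intro s hs
          rw [Finset.mem_Ico] at hs
          exact ⟨Finset.mem_image.2 ⟨s - t, Finset.mem_range.2 (by omega), by congr 1; omega⟩,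
            Finset.mem_image.2 ⟨s + 1 - t, Finset.mem_range.2 (by omega), by congr 1; omega⟩⟩)
      rw [Finset.sum_Ico_eq_sum_range, Nat.add_sub_cancel_left] at this
      refine le_trans (le_of_eq (Finset.sum_congr rfl fun s _ => ?_))
        (this.trans (sum_image_le_sum _ _ κ hκ))
      congr 2; ring
    -- Over all `L` starting points, each `ω` term is counted `q` times and each `κ` term `q + 1`
    -- times.
    have tot := Finset.sum_le_sum fun t (_ : t ∈ Finset.range L) => key t
    rw [Finset.sum_comm, Finset.sum_comm (s := Finset.range L)] at tot
    simp only [hbsum, hcsum, Finset.sum_const, Finset.card_range, nsmul_eq_mul] at tot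
    push_cast at tot
    have : (q : ℝ) * (r * ∑ t ∈ Finset.range L, κ (c t)) =
        (q + 1) * ∑ t ∈ Finset.range L, κ (c t) := by
      rw [hr]; field_simp
    have h4 := mul_lt_mul_of_pos_left hcon hq0
    linarith

/-- Two perfect matchings between `B` and `C` whose swappable segments do not gain. -/
theorem sum_le_of_matchings {α β : Type*} [DecidableEq α] [DecidableEq β]
    (E₁ E₂ : α → β → Prop) (ω : α → ℝ) (κ : β → ℝ) (hκ : ∀ x, 0 ≤ κ x) (q : ℕ) (hq : 1 ≤ q)
    (B : Finset α) (C : Finset β) (N₁ N₂ : B ≃ C)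
    (hN₁ : ∀ a : B, E₁ a (N₁ a)) (hN₂ : ∀ a : B, E₂ a (N₂ a))
    (H : ∀ (A : Finset α) (D : Finset β), A ⊆ B → D ⊆ C → A.card ≤ q → D.card ≤ q + 1 →
      Swappable E₁ A D → Swappable E₂ A D → ∑ a ∈ A, ω a ≤ ∑ x ∈ D, κ x) :
    ∑ a ∈ B, ω a ≤ (1 + 1 / (q : ℝ)) * ∑ x ∈ C, κ x := by
  rcases B.eq_empty_or_nonempty with hB | ⟨a₀, ha₀⟩
  · rw [hB, Finset.sum_empty]
    have := Finset.sum_nonneg fun x (_ : x ∈ C) => hκ x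
    positivity
  have hsw : ∀ (E : α → β → Prop) (A : Finset B) (D : Finset C),
      Swappable (fun (a : B) (x : C) => E a x) A D →
      Swappable E (A.map (Function.Embedding.subtype _)) (D.map (Function.Embedding.subtype _)) := by
    rintro E A D ⟨d, hd, hS⟩
    refine ⟨fun a => if h : a ∈ B then d ⟨a, h⟩ else d ⟨a₀, ha₀⟩, ?_, ?_⟩
    · intro a ha
      obtain ⟨a, ha', rfl⟩ := Finset.mem_map.1 ha
      have := hd a ha'
      simpa using this
    · intro S hSA hSne
      obtain ⟨T, hTA, rfl⟩ := Finset.subset_map_iff.1 hSA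
      obtain ⟨j, hj, hij⟩ := hS T hTA (Finset.map_nonempty.1 hSne)
      refine ⟨j, Finset.mem_map_of_mem _ hj, fun i hi hne => ?_⟩
      obtain ⟨i, hi', rfl⟩ := Finset.mem_map.1 hi
      have := hij i hi' (fun h => hne (by rw [h]; rfl))
      simpa using this
  -- The cycles of `π` are the closed walks. From every start the walk runs for `orderOf π` steps,
  -- perhaps several turns, so summing over starts counts all elements equally and no cycle
  -- decomposition is needed.
  let π : Equiv.Perm B := N₂.trans N₁.symm
  have hpos : 0 < orderOf π := orderOf_pos π
  have key : ∀ a : B, ∑ t ∈ Finset.range (orderOf π), ω ((π ^ t) a : B) ≤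
      (1 + 1 / (q : ℝ)) * ∑ t ∈ Finset.range (orderOf π), κ (N₂ ((π ^ t) a)) := by
    intro a
    refine sum_le_of_closed_walk (fun (a : B) (x : C) => E₁ a x) (fun a x => E₂ a x)
      (fun a => ω a) (fun x => κ x) (fun x => hκ x) q hq ?_ (orderOf π) hpos
      (fun t => (π ^ t) a) (fun t => N₂ ((π ^ t) a)) (fun t _ => hN₂ _) (fun t _ => ?_) ?_
    · intro A D hA hD h1 h2
      have := H _ _ (Finset.map_subtype_subset A) (Finset.map_subtype_subset D)
        (by simpa using hA) (by simpa using hD) (hsw _ _ _ h1) (hsw _ _ _ h2)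
      simpa using this
    · have := hN₁ (π ((π ^ t) a))
      simpa [π, pow_succ'] using this
    · have := hN₁ (π ((π ^ (orderOf π - 1)) a))
      have h' : π ((π ^ (orderOf π - 1)) a) = a := by
        rw [← Equiv.Perm.mul_apply, ← pow_succ', Nat.sub_add_cancel hpos, pow_orderOf_eq_one]
        rfl
      rw [h'] at this
      have h2 : N₁ a = N₂ ((π ^ (orderOf π - 1)) a) := by
        conv_lhs => rw [← h']
        simp [π]
      simpa [h2] using this
  have tot := Finset.sum_le_sum fun a (_ : a ∈ (Finset.univ : Finset B)) => key a
  rw [← Finset.mul_sum, Finset.sum_comm, Finset.sum_comm (s := Finset.univ)] at tot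
  have e1 : ∀ t, ∑ a : B, ω ((π ^ t) a : B) = ∑ a ∈ B, ω a := fun t => by
    rw [Equiv.sum_comp (π ^ t) fun a : B => ω a, Finset.sum_coe_sort]
  have e2 : ∀ t, ∑ a : B, κ (N₂ ((π ^ t) a)) = ∑ x ∈ C, κ x := fun t => by
    rw [Equiv.sum_comp (π ^ t) fun a : B => κ (N₂ a), Equiv.sum_comp N₂ fun x : C => κ x,
      Finset.sum_coe_sort]
  simp only [e1, e2, Finset.sum_const, Finset.card_range, nsmul_eq_mul] at tot
  have hp : (0 : ℝ) < orderOf π := by exact_mod_cast hpos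
  refine le_of_mul_le_mul_left ?_ hp
  linarith

/-! ### Exchange properties of matroids. -/

/-- Finite families of sets satisfying the matroid axioms (nonemptiness is not needed). -/
structure IsFinMatroid {α : Type*} [DecidableEq α] (Ind : Finset α → Prop) : Prop where
  mono : ∀ X Y : Finset α, X ⊆ Y → Ind Y → Ind X
  augment : ∀ X Y : Finset α, Ind X → Ind Y → X.card < Y.card →
    ∃ e ∈ Y, e ∉ X ∧ Ind (insert e X)

namespace IsFinMatroid

variable {α : Type*} [DecidableEq α] {Ind : Finset α → Prop}

theorem exists_extension (hM : IsFinMatroid Ind) {X Y : Finset α} (hX : Ind X) (hY : Ind Y)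
    (h : X.card ≤ Y.card) : ∃ Z, X ⊆ Z ∧ Z ⊆ X ∪ Y ∧ Z.card = Y.card ∧ Ind Z := by
  obtain ⟨k, hk⟩ := Nat.exists_eq_add_of_le h
  induction k generalizing X with
  | zero => exact ⟨X, subset_rfl, Finset.subset_union_left, by omega, hX⟩
  | succ k ih =>
    obtain ⟨e, heY, heX, he⟩ := hM.augment X Y hX hY (by omega)
    have hc := Finset.card_insert_of_notMem heX
    obtain ⟨Z, h1, h2, h3, h4⟩ := ih he (by omega) (by omega)
    exact ⟨Z, (Finset.subset_insert _ _).trans h1, fun x hx => by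
      have := h2 hx; grind, h3, h4⟩

/-- The element `j` whose partner `d j` no other inserted element can replace is swapped last. If
that swap failed, two augmentations would produce another inserted `f` able to replace `d j`. -/
theorem ind_of_swappable (hM : IsFinMatroid Ind) {X A D : Finset α} (hX : Ind X)
    (hAX : Disjoint A X) (hDX : D ⊆ X)
    (hsw : Swappable (fun a x => Ind (insert a (X.erase x))) A D) : Ind (X \ D ∪ A) := by
  obtain ⟨d, hd, hS⟩ := hsw
  have key : ∀ S : Finset α, S ⊆ A → (S.image d).card = S.card ∧ Ind (X \ S.image d ∪ S) := by
    intro S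
    induction S using Finset.strongInduction with
    | H S ih =>
    intro hSA
    rcases S.eq_empty_or_nonempty with rfl | hne
    · simpa using hX
    obtain ⟨j, hj, hij⟩ := hS S hSA hne
    obtain ⟨ihc, ihI⟩ := ih (S.erase j) (Finset.erase_ssubset hj)
      ((Finset.erase_subset _ _).trans hSA)
    have hdj : d j ∉ (S.erase j).image d := by
      intro h
      obtain ⟨i, hi, hdi⟩ := Finset.mem_image.1 h
      rw [Finset.mem_erase] at hi
      exact hij i hi.2 hi.1 (hdi ▸ (hd i (hSA hi.2)).2)
    have himg : S.image d = insert (d j) ((S.erase j).image d) := by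
      conv_lhs => rw [← Finset.insert_erase hj, Finset.image_insert]
    have hsub : (S.erase j).image d ⊆ X := by
      intro x hx
      obtain ⟨i, hi, rfl⟩ := Finset.mem_image.1 hx
      exact hDX (hd i (hSA (Finset.mem_of_mem_erase hi))).1
    have hdjX : d j ∈ X := hDX (hd j (hSA hj)).1
    have hSX : ∀ a ∈ S, a ∉ X := fun a ha => Finset.disjoint_left.1 hAX (hSA ha)
    have hScard : (S.erase j).card + 1 = S.card := Finset.card_erase_add_one hj
    refine ⟨by rw [himg, Finset.card_insert_of_notMem hdj]; omega, ?_⟩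
    obtain ⟨X', hX'⟩ : ∃ X', X' = X \ (S.erase j).image d ∪ S.erase j := ⟨_, rfl⟩
    have hcard : X'.card = X.card := by
      rw [hX', Finset.card_union_of_disjoint, Finset.card_sdiff_of_subset hsub]
      · have := Finset.card_le_card hsub
        omega
      · rw [Finset.disjoint_left]
        intro a ha ha'
        exact hSX a (Finset.mem_of_mem_erase ha') (Finset.mem_sdiff.1 ha).1
    have hdX' : d j ∈ X' := by
      rw [hX']; exact Finset.mem_union_left _ (Finset.mem_sdiff.2 ⟨hdjX, hdj⟩)
    rw [← hX'] at ihI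
    have hgoal : X \ S.image d ∪ S = insert j (X'.erase (d j)) := by
      have hdjS : d j ∉ S := fun h => hSX _ h hdjX
      rw [himg, hX']
      ext x
      simp only [Finset.mem_union, Finset.mem_sdiff, Finset.mem_insert, Finset.mem_erase]
      by_cases hxj : x = j
      · subst hxj; simp [hj]
      · by_cases hxd : x = d j
        · subst hxd; simp [hdjS, hxj]
        · simp [hxj, hxd]
    rw [hgoal]
    have hjX : j ∉ X := hSX j hj
    have hXpos : 0 < X.card := Finset.card_pos.2 ⟨_, hdjX⟩
    have c1 : (insert j (X.erase (d j))).card = X.card := by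
      rw [Finset.card_insert_of_notMem (fun h => hjX (Finset.mem_of_mem_erase h)),
        Finset.card_erase_of_mem hdjX]; omega
    have c2 : (X'.erase (d j)).card = X.card - 1 := by
      rw [Finset.card_erase_of_mem hdX', hcard]
    obtain ⟨e, he, heX', heI⟩ := hM.augment (X'.erase (d j)) (insert j (X.erase (d j)))
      (hM.mono _ _ (Finset.erase_subset _ _) ihI) (hd j (hSA hj)).2 (by omega)
    rcases Finset.mem_insert.1 he with rfl | heX
    · exact heI
    exfalso
    obtain ⟨f, hf, hfX, hfI⟩ := hM.augment (X.erase (d j)) (insert e (X'.erase (d j)))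
      (hM.mono _ _ (Finset.erase_subset _ _) hX) heI (by
        rw [Finset.card_insert_of_notMem heX', Finset.card_erase_of_mem hdjX]; omega)
    rcases Finset.mem_insert.1 hf with rfl | hf
    · exact hfX heX
    · rw [Finset.mem_erase, hX', Finset.mem_union, Finset.mem_sdiff] at hf
      rcases hf with ⟨hne, ⟨hfX', -⟩ | hfS⟩
      · exact hfX (Finset.mem_erase.2 ⟨hne, hfX'⟩)
      · rw [Finset.mem_erase] at hfS
        exact hij f hfS.2 hfS.1 hfI
  refine hM.mono _ _ (Finset.union_subset_union_left (Finset.sdiff_subset_sdiff subset_rfl ?_))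
    (key A subset_rfl).2
  intro x hx
  obtain ⟨i, hi, rfl⟩ := Finset.mem_image.1 hx
  exact (hd i hi).1

/-- Symmetric basis exchange. -/
theorem symmetric_exchange (hM : IsFinMatroid Ind) {X Z : Finset α} (hX : Ind X) (hZ : Ind Z)
    (hc : Z.card = X.card) (hK : ∀ Y, Ind Y → Y.card ≤ X.card) {b : α} (hbZ : b ∈ Z)
    (hbX : b ∉ X) :
    ∃ e ∈ X, e ∉ Z ∧ Ind (insert b (X.erase e)) ∧ Ind (insert e (Z.erase b)) := by
  classical
  -- `insert b U` is the fundamental circuit of `b` in the basis `X`, hence dependent.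
  let U := X.filter fun x => Ind (insert b (X.erase x))
  have hUX : U ⊆ X := Finset.filter_subset _ _
  have hUb : ¬ Ind (insert b U) := by
    intro hI
    obtain ⟨V, h1, h2, h3, h4⟩ := hM.exists_extension hI hX (hK _ hI)
    have : ∃ x ∈ X, x ∉ V := by
      by_contra hcon
      push Not at hcon
      have hsub : insert b X ⊆ V := Finset.insert_subset (h1 (Finset.mem_insert_self _ _)) hcon
      have := Finset.card_le_card hsub
      rw [Finset.card_insert_of_notMem hbX] at this
      omega
    obtain ⟨x, hxX, hxV⟩ := this
    have hVeq : V = insert b (X.erase x) := by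
      refine Finset.eq_of_subset_of_card_le ?_ ?_
      · intro y hy
        have := h2 hy
        have := @hUX y
        grind
      · rw [Finset.card_insert_of_notMem (fun h => hbX (Finset.mem_of_mem_erase h)),
          Finset.card_erase_of_mem hxX]
        have := Finset.card_pos.2 ⟨x, hxX⟩
        omega
    have hxU : x ∈ U := Finset.mem_filter.2 ⟨hxX, hVeq ▸ h4⟩
    exact hxV (h1 (Finset.mem_insert_of_mem hxU))
  -- A set `V ⊇ U` inside `U ∪ Z` of full size must avoid `b`, so whatever it adds to `Z.erase b`
  -- comes from `U`.
  obtain ⟨V, h1, h2, h3, h4⟩ := hM.exists_extension (hM.mono _ _ hUX hX) hZ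
    ((Finset.card_le_card hUX).trans hc.ge)
  have hbV : b ∉ V := fun h => hUb (hM.mono _ _ (Finset.insert_subset h h1) h4)
  obtain ⟨e, heV, heZ, heI⟩ := hM.augment (Z.erase b) V
    (hM.mono _ _ (Finset.erase_subset _ _) hZ) h4 (by
      rw [h3, Finset.card_erase_of_mem hbZ]
      have := Finset.card_pos.2 ⟨b, hbZ⟩
      omega)
  have heb : e ≠ b := fun h => hbV (h ▸ heV)
  have heZ' : e ∉ Z := fun h => heZ (Finset.mem_erase.2 ⟨heb, h⟩)
  have heU : e ∈ U := (Finset.mem_union.1 (h2 heV)).resolve_right heZ'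
  exact ⟨e, hUX heU, heZ', (Finset.mem_filter.1 heU).2, heI⟩

theorem exists_matching (hM : IsFinMatroid Ind) {X Y : Finset α} (hX : Ind X) (hY : Ind Y)
    (hc : Y.card = X.card) (hK : ∀ Z, Ind Z → Z.card ≤ X.card) :
    ∃ N : (Y \ X : Finset α) ≃ (X \ Y : Finset α),
      ∀ b : (Y \ X : Finset α), Ind (insert (b : α) (X.erase (N b))) := by
  classical
  let t : (Y \ X : Finset α) → Finset α := fun b =>
    (X \ Y).filter fun x => Ind (insert (b : α) (X.erase x))
  -- Hall's condition. If `S` had too few neighbours, these together with `X ∩ Y` could be augmented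
  -- by some `e ∈ S` and completed to a basis `Z`; symmetric exchange then yields a neighbour of `e`
  -- outside `Z`.
  have hall : ∀ S : Finset (Y \ X : Finset α), S.card ≤ (S.biUnion t).card := by
    intro S
    by_contra hlt
    push Not at hlt
    have hNsub : S.biUnion t ⊆ X \ Y := Finset.biUnion_subset.2 fun b _ => Finset.filter_subset _ _
    let S' : Finset α := S.map (Function.Embedding.subtype _)
    have hS' : ∀ b ∈ S', b ∈ Y ∧ b ∉ X := by
      intro b hb
      obtain ⟨b, -, rfl⟩ := Finset.mem_map.1 hb
      exact Finset.mem_sdiff.1 b.2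
    obtain ⟨e, he, heN, heI⟩ := hM.augment ((X ∩ Y) ∪ S.biUnion t) ((X ∩ Y) ∪ S')
      (hM.mono _ X (Finset.union_subset Finset.inter_subset_left
        (hNsub.trans Finset.sdiff_subset)) hX)
      (hM.mono _ Y (Finset.union_subset Finset.inter_subset_right fun b hb => (hS' b hb).1) hY)
      (by
        rw [Finset.card_union_of_disjoint, Finset.card_union_of_disjoint]
        · simpa [S'] using hlt
        · rw [Finset.disjoint_left]
          intro a ha ha'
          exact (hS' a ha').2 (Finset.mem_inter.1 ha).1
        · rw [Finset.disjoint_left]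
          intro a ha ha'
          exact (Finset.mem_sdiff.1 (hNsub ha')).2 (Finset.mem_inter.1 ha).2)
    have heS : e ∈ S' := by
      rcases Finset.mem_union.1 he with h | h
      · exact absurd (Finset.mem_union_left _ h) heN
      · exact h
    obtain ⟨Z, hZ1, hZ2, hZ3, hZ4⟩ := hM.exists_extension heI hX (hK _ heI)
    obtain ⟨x, hxX, hxZ, hI1, -⟩ := hM.symmetric_exchange hX hZ4 hZ3 hK
      (hZ1 (Finset.mem_insert_self _ _)) (hS' e heS).2
    have hxY : x ∉ Y := fun h => hxZ (hZ1 (Finset.mem_insert_of_mem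
      (Finset.mem_union_left _ (Finset.mem_inter.2 ⟨hxX, h⟩))))
    obtain ⟨b, hb, rfl⟩ := Finset.mem_map.1 heS
    exact hxZ (hZ1 (Finset.mem_insert_of_mem (Finset.mem_union_right _
      (Finset.mem_biUnion.2 ⟨b, hb, Finset.mem_filter.2 ⟨Finset.mem_sdiff.2 ⟨hxX, hxY⟩, hI1⟩⟩))))
  obtain ⟨f, hfinj, hf⟩ := (Finset.all_card_le_biUnion_card_iff_exists_injective t).1 hall
  have hfm : ∀ b, f b ∈ X \ Y := fun b => (Finset.mem_filter.1 (hf b)).1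
  have hbij : Function.Bijective (fun b => (⟨f b, hfm b⟩ : (X \ Y : Finset α))) := by
    rw [Fintype.bijective_iff_injective_and_card]
    refine ⟨fun a b h => hfinj (Subtype.ext_iff.1 h), ?_⟩
    simp only [Fintype.card_coe]
    exact Finset.card_sdiff_comm hc
  exact ⟨Equiv.ofBijective _ hbij, fun b => (Finset.mem_filter.1 (hf b)).2⟩

/-- Exchange prices: the cost of making room for `A` is bounded by a modular function. -/
theorem exists_prices (hM : IsFinMatroid Ind) (w : α → ℝ) (hw : ∀ x, 0 ≤ w x)
    {X Y : Finset α} (hX : Ind X) (hY : Ind Y) (hc : Y.card = X.card)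
    (hK : ∀ Z, Ind Z → Z.card ≤ X.card) :
    ∃ m : α → ℝ, (∀ b, 0 ≤ m b) ∧ ∑ b ∈ Y \ X, m b ≤ ∑ x ∈ X \ Y, w x ∧
      ∀ A ⊆ Y \ X, ∃ D ⊆ X \ Y, D.card = A.card ∧ Ind (X \ D ∪ A) ∧
        ∑ x ∈ D, w x ≤ ∑ b ∈ A, m b := by
  classical
  obtain ⟨k, hk⟩ : ∃ k, (Y \ X).card = k := ⟨_, rfl⟩
  induction k generalizing X with
  | zero =>
    refine ⟨0, fun _ => le_rfl, ?_, fun A hA => ⟨∅, Finset.empty_subset _, ?_⟩⟩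
    · simpa using Finset.sum_nonneg fun x _ => hw x
    · rw [Finset.card_eq_zero.1 hk, Finset.subset_empty] at hA
      simpa [hA] using hX
  | succ k ih =>
    obtain ⟨b, hb⟩ : (Y \ X).Nonempty := Finset.card_pos.1 (by omega)
    obtain ⟨hbY, hbX⟩ := Finset.mem_sdiff.1 hb
    -- The price of `b` is the weight of the cheapest `c` it can replace; the induction continues
    -- after that swap.
    obtain ⟨c, hcm, hcmin⟩ := ((X \ Y).filter fun x => Ind (insert b (X.erase x))).exists_min_image
      w (by
        obtain ⟨e, h1, h2, h3, -⟩ := hM.symmetric_exchange hX hY hc hK hbY hbX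
        exact ⟨e, Finset.mem_filter.2 ⟨Finset.mem_sdiff.2 ⟨h1, h2⟩, h3⟩⟩)
    obtain ⟨hcXY, hcI⟩ := Finset.mem_filter.1 hcm
    obtain ⟨hcX, hcY⟩ := Finset.mem_sdiff.1 hcXY
    obtain ⟨X₁, hX₁⟩ : ∃ X₁, X₁ = insert b (X.erase c) := ⟨_, rfl⟩
    rw [← hX₁] at hcI
    have hcard : X₁.card = X.card := by
      rw [hX₁, Finset.card_insert_of_notMem (fun h => hbX (Finset.mem_of_mem_erase h)),
        Finset.card_erase_of_mem hcX]
      have := Finset.card_pos.2 ⟨c, hcX⟩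
      omega
    have e1 : Y \ X₁ = (Y \ X).erase b := by
      ext x; rw [hX₁]; clear * - hb hcY; grind
    have e2 : X₁ \ Y = (X \ Y).erase c := by
      ext x; rw [hX₁]; clear * - hbY hcX; grind
    obtain ⟨m, hm0, hm1, hm2⟩ := ih hcI (hc.trans hcard.symm) (fun Z hZ => hcard ▸ hK Z hZ)
      (by rw [e1, Finset.card_erase_of_mem hb]; omega)
    rw [e1] at hm1 hm2
    rw [e2] at hm1 hm2
    have hsumA : ∀ A : Finset α, b ∉ A → ∑ x ∈ A, Function.update m b (w c) x = ∑ x ∈ A, m x :=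
      fun A hA => Finset.sum_congr rfl fun x hx => by
        rw [Function.update_of_ne]; rintro rfl; exact hA hx
    refine ⟨Function.update m b (w c), fun x => ?_, ?_, fun A hA => ?_⟩
    · by_cases h : x = b
      · subst h; simpa using hw c
      · rw [Function.update_of_ne h]; exact hm0 x
    · rw [← Finset.add_sum_erase _ _ hb, ← Finset.add_sum_erase _ _ hcXY,
        hsumA _ (Finset.notMem_erase _ _), Function.update_self]
      linarith
    · by_cases hbA : b ∈ A
      · obtain ⟨D, hD, hDc, hDI, hDw⟩ := hm2 (A.erase b) (Finset.erase_subset_erase _ hA)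
        have hcD : c ∉ D := fun h => Finset.notMem_erase _ _ (hD h)
        refine ⟨insert c D, Finset.insert_subset hcXY (hD.trans (Finset.erase_subset _ _)), ?_,
          ?_, ?_⟩
        · rw [Finset.card_insert_of_notMem hcD, hDc, Finset.card_erase_add_one hbA]
        · refine hM.mono _ _ ?_ hDI
          intro x hx
          have := @hD b
          rw [hX₁]; clear * - hx this hbY hbX hcX hbA; grind
        · rw [Finset.sum_insert hcD, ← Finset.add_sum_erase _ _ hbA, Function.update_self,
            hsumA _ (Finset.notMem_erase _ _)]
          linarith
      · have hA' : A ⊆ (Y \ X).erase b := fun x hx =>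
          Finset.mem_erase.2 ⟨fun h => hbA (h ▸ hx), hA hx⟩
        obtain ⟨D, hD, hDc, hDI, hDw⟩ := hm2 A hA'
        have hcD : c ∉ D := fun h => Finset.notMem_erase _ _ (hD h)
        have hDX₁ : D ⊆ X₁ := fun x hx => by
          have := hD hx; rw [hX₁]; clear * - this; grind
        obtain ⟨Z, hZ⟩ : ∃ Z, Z = X₁ \ D ∪ A := ⟨_, rfl⟩
        rw [← hZ] at hDI
        have hZc : Z.card = X.card := by
          rw [hZ, Finset.card_union_of_disjoint, Finset.card_sdiff_of_subset hDX₁]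
          · have := Finset.card_le_card hDX₁; omega
          · rw [Finset.disjoint_left]
            intro x hx hxA
            have := hA' hxA; rw [hX₁] at hx; clear * - this hx; grind
        have hbZ : b ∈ Z := by
          have := @hD b
          rw [hZ, hX₁]; clear * - this hbY; grind
        -- Since `b ∉ A`, it is traded back for some `e` in `insert c D`. The choice of `c` gives `w
        -- c ≤ w e`, so the cost does not rise.
        obtain ⟨e, heX, heZ, hI1, hI2⟩ := hM.symmetric_exchange hX hDI hZc hK hbZ hbX
        have heD : e ∈ insert c D := by
          rw [hZ, hX₁] at heZ; clear * - heZ heX; grind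
        have heXY : e ∈ X \ Y := by
          rcases Finset.mem_insert.1 heD with rfl | h
          · exact hcXY
          · exact Finset.mem_of_mem_erase (hD h)
        have hwe := hcmin e (Finset.mem_filter.2 ⟨heXY, hI1⟩)
        refine ⟨(insert c D).erase e, ?_, ?_, ?_, ?_⟩
        · intro x hx
          have := @hD x; clear * - this hx hcXY; grind
        · rw [Finset.card_erase_of_mem heD, Finset.card_insert_of_notMem hcD, hDc]; rfl
        · refine hM.mono _ _ ?_ hI2
          intro x hx
          have := @hA x
          rw [hZ, hX₁]; clear * - this hx hbX hbA; grind
        · have := Finset.add_sum_erase _ w heD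
          rw [Finset.sum_insert hcD] at this
          rw [hsumA A hbA]; linarith

end IsFinMatroid

/-! ### Local optima over matroid intersections. -/

theorem sum_union_le {α : Type*} [DecidableEq α] (w : α → ℝ) (hw : ∀ x, 0 ≤ w x)
    (A B : Finset α) : ∑ x ∈ A ∪ B, w x ≤ ∑ x ∈ A, w x + ∑ x ∈ B, w x := by
  rw [← Finset.sum_union_inter]
  linarith [Finset.sum_nonneg fun x (_ : x ∈ A ∩ B) => hw x]

theorem sum_biUnion_le {α ι : Type*} [DecidableEq α] (w : α → ℝ)
    (hw : ∀ x, 0 ≤ w x) (S : Finset ι) (D : ι → Finset α) :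
    ∑ x ∈ S.biUnion D, w x ≤ ∑ i ∈ S, ∑ x ∈ D i, w x := by
  classical
  induction S using Finset.induction_on with
  | empty => simp
  | insert a S ha ih =>
    rw [Finset.biUnion_insert, Finset.sum_insert ha]
    exact (sum_union_le w hw _ _).trans (by linarith)

/-- A local optimum over the common bases of several matroids. -/
theorem IsFinMatroid.sum_le_of_local_opt {α ι : Type*} [DecidableEq α] [Fintype ι]
    [DecidableEq ι] (Ind : ι → Finset α → Prop) (hM : ∀ i, IsFinMatroid (Ind i)) {i₀ i₁ : ι}
    (hne : i₀ ≠ i₁) (X Y : Finset α) (hX : ∀ i, Ind i X) (hY : ∀ i, Ind i Y)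
    (hc : Y.card = X.card) (hK : ∀ i Z, Ind i Z → Z.card ≤ X.card) (q : ℕ) (hq : 1 ≤ q)
    (ω w : α → ℝ) (hw : ∀ x, 0 ≤ w x)
    (H : ∀ A ⊆ Y \ X, ∀ D ⊆ X \ Y, A.card ≤ q → D.card ≤ q + 1 + (Fintype.card ι - 2) * q →
      (∀ i, Ind i (X \ D ∪ A)) → ∑ a ∈ A, ω a ≤ ∑ x ∈ D, w x) :
    ∑ a ∈ Y \ X, ω a ≤ ((Fintype.card ι : ℝ) - 1 + 1 / (q : ℝ)) * ∑ x ∈ X \ Y, w x := by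
  choose m hm0 hm1 hm2 using fun i => (hM i).exists_prices w hw (hX i) (hY i) hc (hK i)
  obtain ⟨N₁, hN₁⟩ := (hM i₀).exists_matching (hX i₀) (hY i₀) hc (hK i₀)
  obtain ⟨N₂, hN₂⟩ := (hM i₁).exists_matching (hX i₁) (hY i₁) hc (hK i₁)
  let R : Finset ι := (Finset.univ.erase i₀).erase i₁
  have hRc : R.card = Fintype.card ι - 2 := by
    rw [Finset.card_erase_of_mem (Finset.mem_erase.2 ⟨hne.symm, Finset.mem_univ _⟩),
      Finset.card_erase_of_mem (Finset.mem_univ _), Finset.card_univ]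
    omega
  have h2 : 2 ≤ Fintype.card ι := by
    have := Finset.card_le_univ ({i₀, i₁} : Finset ι)
    rwa [Finset.card_pair hne] at this
  -- Subtracting the prices of the other matroids from `ω` leaves only `i₀` and `i₁` to the walk
  -- argument; the prices total at most `p - 2` times the weight of `X \ Y`, where `p` is the number
  -- of matroids.
  have key := sum_le_of_matchings (fun a x => Ind i₀ (insert a (X.erase x)))
    (fun a x => Ind i₁ (insert a (X.erase x))) (fun a => ω a - ∑ i ∈ R, m i a) w hw q hq
    (Y \ X) (X \ Y) N₁ N₂ hN₁ hN₂ (by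
      intro A D₀ hA hD₀ hAq hD₀q s₁ s₂
      choose D hDX hDc hDI hDw using fun i => hm2 i A hA
      have hAX : Disjoint A X := Finset.disjoint_left.2 fun a ha => (Finset.mem_sdiff.1 (hA ha)).2
      have hD₀X : D₀ ⊆ X := hD₀.trans Finset.sdiff_subset
      have hmono : ∀ i D', D' ⊆ D₀ ∪ R.biUnion D → Ind i (X \ D' ∪ A) →
          Ind i (X \ (D₀ ∪ R.biUnion D) ∪ A) := fun i D' h hI =>
        (hM i).mono _ _ (Finset.union_subset_union_left
          (Finset.sdiff_subset_sdiff subset_rfl h)) hI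
      have := H A hA (D₀ ∪ R.biUnion D)
        (Finset.union_subset hD₀ (Finset.biUnion_subset.2 fun i _ => hDX i)) hAq
        ((Finset.card_union_le _ _).trans (add_le_add hD₀q (by
          rw [← hRc]
          refine Finset.card_biUnion_le_card_mul _ _ _ fun i _ => ?_
          rw [hDc]; exact hAq)))
        (by
          intro i
          by_cases h0 : i = i₀
          · subst h0
            exact hmono _ D₀ Finset.subset_union_left ((hM _).ind_of_swappable (hX _) hAX hD₀X s₁)
          by_cases h1 : i = i₁
          · subst h1
            exact hmono _ D₀ Finset.subset_union_left ((hM _).ind_of_swappable (hX _) hAX hD₀X s₂)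
          · exact hmono _ (D i) ((Finset.subset_biUnion_of_mem D (Finset.mem_erase.2
              ⟨h1, Finset.mem_erase.2 ⟨h0, Finset.mem_univ _⟩⟩)).trans
              Finset.subset_union_right) (hDI i))
      have u1 := sum_union_le w hw D₀ (R.biUnion D)
      have u2 := sum_biUnion_le w hw R D
      have u3 := Finset.sum_le_sum fun i (_ : i ∈ R) => hDw i
      rw [Finset.sum_comm] at u3
      rw [Finset.sum_sub_distrib]
      linarith)
  rw [Finset.sum_sub_distrib, Finset.sum_comm] at key
  have := Finset.sum_le_sum fun i (_ : i ∈ R) => hm1 i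
  rw [Finset.sum_const, hRc, nsmul_eq_mul, Nat.cast_sub h2] at this
  push_cast at this
  linarith

theorem isFinMatroid_of_matroid {α : Type*} [DecidableEq α] (M : Matroid α) :
    IsFinMatroid fun X : Finset α => M.Indep (X : Set α) where
  mono X Y h hY := hY.subset (by exact_mod_cast h)
  augment X Y hX hY h := by
    obtain ⟨e, he, hI⟩ := hX.augment hY (by simpa using h)
    exact ⟨e, by simpa using he.1, by simpa using he.2, by simpa using hI⟩

/-- Truncation of the sum with a free matroid. -/
theorem IsFinMatroid.pad {α β : Type*} [DecidableEq α] [DecidableEq β] {Ind : Finset α → Prop}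
    (hM : IsFinMatroid Ind) (K : ℕ) :
    IsFinMatroid fun Z : Finset (α ⊕ β) => Ind Z.toLeft ∧ Z.card ≤ K where
  mono X Y h hY := ⟨hM.mono _ _ (Finset.toLeft_subset_toLeft h) hY.1,
    (Finset.card_le_card h).trans hY.2⟩
  augment X Y hX hY h := by
    have hcard : ∀ e ∉ X, (insert e X).card ≤ K := fun e he => by
      rw [Finset.card_insert_of_notMem he]; have := hY.2; omega
    by_cases hr : Y.toRight ⊆ X.toRight
    · have h1 := Finset.card_le_card hr
      have h2 := Finset.card_toLeft_add_card_toRight (u := X)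
      have h3 := Finset.card_toLeft_add_card_toRight (u := Y)
      obtain ⟨e, heY, heX, hI⟩ := hM.augment _ _ hX.1 hY.1 (by omega)
      rw [Finset.mem_toLeft] at heY heX
      refine ⟨Sum.inl e, heY, heX, ?_, hcard _ heX⟩
      convert hI using 1
      ext x; simp
    · obtain ⟨e, heY, heX⟩ := Finset.not_subset.1 hr
      rw [Finset.mem_toRight] at heY heX
      refine ⟨Sum.inr e, heY, heX, ?_, hcard _ heX⟩
      convert hX.1 using 1
      ext x; simp

theorem sum_sumElim_zero {α β : Type*} (w : α → ℝ) (Z : Finset (α ⊕ β)) :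
    ∑ z ∈ Z, Sum.elim w (fun _ => 0) z = ∑ x ∈ Z.toLeft, w x := by
  conv_lhs => rw [← Finset.toLeft_disjSum_toRight (u := Z)]
  rw [Finset.sum_disjSum]
  simp

/-- Padding by weightless dummies turns `X` and `Y` into common bases `X ⊎ Y` and `Y ⊎ X` of the
truncated matroids. Charging `η` to each genuine inserted element pays the slack of every move that
inserts one. -/
theorem sum_le_of_local_opt_matroidIntersection {n p q : ℕ} (hp : 2 ≤ p) (hq : 1 ≤ q)
    {I : Set (Finset (Fin n))} (hI : IsMatroidIntersection p I) {X Y : Finset (Fin n)}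
    (hX : X ∈ I) (hY : Y ∈ I) (w : Fin n → ℝ) (hw : ∀ x, 0 ≤ w x) (η : ℝ) (hη : 0 ≤ η)
    (H : ∀ T ∈ ConstraintKind.matroidIntersection.reachable p q I X,
      ∑ x ∈ T \ X, w x ≤ ∑ x ∈ X \ T, w x + η) :
    ∑ x ∈ Y \ X, w x ≤ ((p : ℝ) - 1 + 1 / (q : ℝ)) * ∑ x ∈ X \ Y, w x + n * η := by
  obtain ⟨M, -, hM⟩ := hI
  have hleft : ∀ X Y : Finset (Fin n), (X.disjSum Y : Finset (Fin n ⊕ Fin n)).toLeft = X :=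
    fun X Y => Finset.toLeft_disjSum
  have hsd : ∀ Z W : Finset (Fin n ⊕ Fin n), (Z \ W).toLeft = Z.toLeft \ W.toLeft := fun Z W => by
    ext; simp
  have hun : ∀ Z W : Finset (Fin n ⊕ Fin n), (Z ∪ W).toLeft = Z.toLeft ∪ W.toLeft := fun Z W => by
    ext; simp
  have key := IsFinMatroid.sum_le_of_local_opt
    (fun (i : Fin p) (Z : Finset (Fin n ⊕ Fin n)) =>
      (M i).Indep (Z.toLeft : Set (Fin n)) ∧ Z.card ≤ X.card + Y.card)
    (fun i => (isFinMatroid_of_matroid (M i)).pad _)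
    (i₀ := ⟨0, by omega⟩) (i₁ := ⟨1, by omega⟩) (by simp)
    (X.disjSum Y) (Y.disjSum X)
    (fun i => ⟨by rw [hleft]; exact (hM X).1 hX i, by rw [Finset.card_disjSum]⟩)
    (fun i => ⟨by rw [hleft]; exact (hM Y).1 hY i, by rw [Finset.card_disjSum, add_comm]⟩)
    (by rw [Finset.card_disjSum, Finset.card_disjSum, add_comm])
    (fun i Z hZ => by rw [Finset.card_disjSum]; exact hZ.2) q hq
    (Sum.elim (fun x => w x - η) fun _ => 0) (Sum.elim w fun _ => 0)
    (by rintro (x | x) <;> simp [hw])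
    (by
      intro A hA D hD hAq hDq hInd
      rw [sum_sumElim_zero, sum_sumElim_zero]
      have hAL := Finset.toLeft_subset_toLeft hA
      have hDL := Finset.toLeft_subset_toLeft hD
      rw [hsd, hleft, hleft] at hAL hDL
      -- If only dummies are inserted, no `η` is available for the slack, but the left side
      -- vanishes.
      rcases A.toLeft.eq_empty_or_nonempty with hemp | hne
      · rw [hemp, Finset.sum_empty]; exact Finset.sum_nonneg fun x _ => hw x
      have e1 : (X \ D.toLeft ∪ A.toLeft) \ X = A.toLeft := by
        ext x; have := @hAL x; clear * - this; grind
      have e2 : X \ (X \ D.toLeft ∪ A.toLeft) = D.toLeft := by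
        ext x; have := @hAL x; have h2 := @hDL x; clear * - this h2; grind
      have hAc : A.toLeft.card ≤ q := Finset.card_toLeft_le.trans hAq
      have hDc := (Finset.card_toLeft_le (u := D)).trans hDq
      have hT := H (X \ D.toLeft ∪ A.toLeft) ⟨(hM _).2 fun i => by
          have := (hInd i).1
          rwa [hun, hsd, hleft] at this, by
          rw [e1]; simp only [ConstraintKind.maxInsert]; omega, by
          rw [e2]; simp only [ConstraintKind.maxDelete]
          refine hDc.trans ?_
          rw [Fintype.card_fin]
          obtain ⟨k, rfl⟩ := Nat.exists_eq_add_of_le hp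
          rw [Nat.add_sub_cancel_left]
          nlinarith [Nat.zero_le (k * q)]⟩
      rw [e1, e2] at hT
      have h1 : (1 : ℝ) ≤ A.toLeft.card := by exact_mod_cast hne.card_pos
      rw [Finset.sum_sub_distrib, Finset.sum_const, nsmul_eq_mul]
      nlinarith)
  rw [sum_sumElim_zero, sum_sumElim_zero, hsd, hsd, hleft, hleft, Fintype.card_fin,
    Finset.sum_sub_distrib, Finset.sum_const, nsmul_eq_mul] at key
  have h1 : ((Y \ X).card : ℝ) ≤ n := by
    exact_mod_cast (Finset.card_le_univ _).trans (Fintype.card_fin n).le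
  nlinarith

/-! ### Local optima over exchange systems. -/

/-- A regular bipartite multigraph contains a perfect matching. -/
theorem exists_perm_of_regular {V : Type*} [Fintype V] [DecidableEq V] (k : ℕ) (R : V → V → ℕ)
    (hr : ∀ i, ∑ j, R i j = k + 1) (hc : ∀ j, ∑ i, R i j = k + 1) :
    ∃ (σ : Equiv.Perm V) (R' : V → V → ℕ),
      (∀ i j, R i j = R' i j + if σ i = j then 1 else 0) ∧
      (∀ i, ∑ j, R' i j = k) ∧ ∀ j, ∑ i, R' i j = k := by
  let t : V → Finset V := fun i => Finset.univ.filter fun j => 0 < R i j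
  -- Hall's condition by double counting: `S` emits `|S| (k + 1)` edges, and each neighbour receives
  -- at most `k + 1`.
  have hall : ∀ S : Finset V, S.card ≤ (S.biUnion t).card := by
    intro S
    have h1 : ∑ i ∈ S, ∑ j ∈ S.biUnion t, R i j = S.card * (k + 1) := by
      rw [← smul_eq_mul, ← Finset.sum_const]
      refine Finset.sum_congr rfl fun i hi => ?_
      rw [← hr i]
      refine Finset.sum_subset (Finset.subset_univ _) fun j _ hj => ?_
      by_contra h
      exact hj (Finset.mem_biUnion.2 ⟨i, hi, Finset.mem_filter.2
        ⟨Finset.mem_univ _, Nat.pos_of_ne_zero h⟩⟩)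
    have h2 : ∑ j ∈ S.biUnion t, ∑ i ∈ S, R i j ≤ (S.biUnion t).card * (k + 1) := by
      rw [← smul_eq_mul, ← Finset.sum_const]
      refine Finset.sum_le_sum fun j _ => ?_
      rw [← hc j]
      exact Finset.sum_le_sum_of_subset (Finset.subset_univ _)
    rw [Finset.sum_comm, h1] at h2
    exact Nat.le_of_mul_le_mul_right h2 (Nat.succ_pos k)
  obtain ⟨f, hinj, hf⟩ := (Finset.all_card_le_biUnion_card_iff_exists_injective t).1 hall
  let σ : Equiv.Perm V := Equiv.ofBijective f (Finite.injective_iff_bijective.1 hinj)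
  have hσ : ∀ i, 0 < R i (σ i) := fun i => (Finset.mem_filter.1 (hf i)).2
  have hR : ∀ i j, R i j = (R i j - if σ i = j then 1 else 0) + if σ i = j then 1 else 0 := by
    intro i j
    split_ifs with h
    · have := hσ i
      rw [h] at this; omega
    · omega
  refine ⟨σ, fun i j => R i j - if σ i = j then 1 else 0, hR, fun i => ?_, fun j => ?_⟩
  · have := hr i
    rw [Finset.sum_congr rfl fun j _ => hR i j, Finset.sum_add_distrib] at this
    simpa using this
  · have := hc j
    rw [Finset.sum_congr rfl fun i _ => hR i j, Finset.sum_add_distrib] at this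
    have e : ∀ i, (σ i = j) ↔ (i = σ.symm j) := fun i => σ.eq_symm_apply.symm
    simpa [e] using this

/-- A bipartite graph of maximum degree `k + 2` embeds into a `k + 2`-regular multigraph, from
which two perfect matchings are removed. -/
theorem exists_two_perms {α : Type*} [Fintype α] [DecidableEq α] (k : ℕ) (φ : α → Finset α)
    (h1 : ∀ v, (φ v).card ≤ k + 2)
    (h2 : ∀ x, (Finset.univ.filter fun v => x ∈ φ v).card ≤ k + 2) :
    ∃ (σ τ : Equiv.Perm (α ⊕ α)) (R : α → α → ℕ),
      (∀ v, ∀ x ∈ φ v, σ (Sum.inl v) = Sum.inl x ∨ τ (Sum.inl v) = Sum.inl x ∨ 0 < R v x) ∧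
      (∀ v, ∑ x, R v x ≤ k) ∧ ∀ x, ∑ v, R v x ≤ k := by
  -- Two copies of the graph, the second reversed, with each vertex joined to its twin by as many
  -- edges as its degree lacks.
  let Q : α ⊕ α → α ⊕ α → ℕ := fun i j => match i, j with
    | .inl v, .inl x => if x ∈ φ v then 1 else 0
    | .inl v, .inr v' => if v = v' then k + 2 - (φ v).card else 0
    | .inr x, .inl x' => if x = x' then k + 2 - (Finset.univ.filter fun v => x ∈ φ v).card else 0
    | .inr x, .inr v => if x ∈ φ v then 1 else 0
  obtain ⟨σ, R₁, hσ, hr₁, hc₁⟩ := exists_perm_of_regular (k + 1) Q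
    (by
      rintro (v | x)
      · simp only [Fintype.sum_sum_type, Q]
        have := h1 v
        simp only [Finset.sum_boole, Finset.sum_ite_eq, Finset.mem_univ, if_true,
          Finset.filter_univ_mem, Nat.cast_id]
        omega
      · simp only [Fintype.sum_sum_type, Q]
        have := h2 x
        simp only [Finset.sum_boole, Finset.sum_ite_eq, Finset.mem_univ, if_true, Nat.cast_id]
        omega)
    (by
      rintro (x | v)
      · simp only [Fintype.sum_sum_type, Q]
        have := h2 x
        simp only [Finset.sum_boole, Finset.sum_ite_eq', Finset.mem_univ, if_true, Nat.cast_id]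
        omega
      · simp only [Fintype.sum_sum_type, Q]
        have := h1 v
        simp only [Finset.sum_boole, Finset.sum_ite_eq', Finset.mem_univ, if_true,
          Finset.filter_univ_mem, Nat.cast_id]
        omega)
  obtain ⟨τ, R₂, hτ, hr₂, hc₂⟩ := exists_perm_of_regular k R₁ hr₁ hc₁
  refine ⟨σ, τ, fun v x => R₂ (Sum.inl v) (Sum.inl x), fun v x hx => ?_, fun v => ?_, fun x => ?_⟩
  · by_contra hcon
    push Not at hcon
    obtain ⟨g1, g2, g3⟩ := hcon
    have := hσ (Sum.inl v) (Sum.inl x)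
    rw [hτ, if_neg g1, if_neg g2] at this
    simp only [Q, if_pos hx] at this
    omega
  · have := hr₂ (Sum.inl v)
    rw [Fintype.sum_sum_type] at this
    dsimp only
    omega
  · have := hc₂ (Sum.inl x)
    rw [Fintype.sum_sum_type] at this
    dsimp only
    omega

/-- Deleting all of `φ` over the inserted set is always legal, so acyclicity of the windows plays no
role. Those deletions lie in the window and the leftover neighbours `ρ`: at most `(q + 1) + (p - 2)
q = pq - q + 1`, exactly what a move allows. -/
theorem sum_le_of_local_opt_exchangeSystem {n p q : ℕ} (hp : 2 ≤ p) (hq : 1 ≤ q)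
    {I : Set (Finset (Fin n))} (hI : IsExchangeSystem p I) {X Y : Finset (Fin n)}
    (hX : X ∈ I) (hY : Y ∈ I) (w : Fin n → ℝ) (hw : ∀ x, 0 ≤ w x) (η : ℝ) (hη : 0 ≤ η)
    (H : ∀ T ∈ ConstraintKind.exchangeSystem.reachable p q I X,
      ∑ x ∈ T \ X, w x ≤ ∑ x ∈ X \ T, w x + η) :
    ∑ x ∈ Y \ X, w x ≤ ((p : ℝ) - 1 + 1 / (q : ℝ)) * ∑ x ∈ X \ Y, w x + n * η := by
  obtain ⟨φ, hφ1, hφ2, hφ3⟩ := hI.2 X hX Y hY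
  obtain ⟨k, rfl⟩ := Nat.exists_eq_add_of_le' hp
  obtain ⟨σ, τ, R, hR, hRr, hRc⟩ := exists_two_perms k
    (fun v => if v ∈ Y \ X then φ v else ∅)
    (fun v => by
      split_ifs with h
      · exact (hφ1 v h).2
      · simp)
    (fun x => by
      by_cases hx : x ∈ X \ Y
      · refine le_trans (Finset.card_le_card fun v hv => ?_) (hφ2 x hx)
        rw [Finset.mem_filter] at hv ⊢
        by_cases h : v ∈ Y \ X
        · rw [if_pos h] at hv; exact ⟨h, hv.2⟩
        · rw [if_neg h] at hv; simp at hv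
      · rw [Finset.filter_eq_empty_iff.2]
        · simp
        · intro v _ hv
          by_cases h : v ∈ Y \ X
          · rw [if_pos h] at hv; exact hx ((hφ1 v h).1 hv)
          · rw [if_neg h] at hv; simp at hv)
  replace hR : ∀ v ∈ Y \ X, ∀ x ∈ φ v,
      σ (Sum.inl v) = Sum.inl x ∨ τ (Sum.inl v) = Sum.inl x ∨ 0 < R v x := fun v hv x hx =>
    hR v x (by rwa [if_pos hv])
  let ρ : Fin n → Finset (Fin n) := fun v => (φ v).filter fun x => 0 < R v x
  have hρc : ∀ v, (ρ v).card ≤ k := fun v => by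
    refine le_trans ?_ (hRr v)
    rw [Finset.card_eq_sum_ones]
    refine le_trans (Finset.sum_le_sum fun x hx => (Finset.mem_filter.1 hx).2)
      (Finset.sum_le_sum_of_subset (Finset.subset_univ _))
  have hρw : ∑ v ∈ Y \ X, ∑ x ∈ ρ v, w x ≤ k * ∑ x ∈ X \ Y, w x := by
    have h1 : ∀ v ∈ Y \ X, ∑ x ∈ ρ v, w x ≤ ∑ x ∈ X \ Y, (R v x : ℝ) * w x := by
      intro v hv
      refine le_trans (Finset.sum_le_sum (g := fun x => (R v x : ℝ) * w x) fun x hx => ?_)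
        (Finset.sum_le_sum_of_subset_of_nonneg
          ((Finset.filter_subset _ _).trans (hφ1 v hv).1) fun x _ _ =>
            mul_nonneg (Nat.cast_nonneg _) (hw x))
      have : (1 : ℝ) ≤ R v x := by exact_mod_cast (Finset.mem_filter.1 hx).2
      nlinarith [hw x]
    refine (Finset.sum_le_sum h1).trans ?_
    rw [Finset.sum_comm, Finset.mul_sum]
    refine Finset.sum_le_sum fun x _ => ?_
    rw [← Finset.sum_mul]
    refine mul_le_mul_of_nonneg_right ?_ (hw x)
    exact_mod_cast (Finset.sum_le_sum_of_subset (Finset.subset_univ _)).trans (hRc x)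
  let ν : (Finset.univ : Finset (Fin n ⊕ Fin n)) ≃ (Fin n ⊕ Fin n) :=
    Equiv.subtypeUnivEquiv Finset.mem_univ
  have key := sum_le_of_matchings (fun a x => σ a = x) (fun a x => τ a = x)
    (Sum.elim (fun v => if v ∈ Y \ X then w v - ∑ x ∈ ρ v, w x - η else 0) fun _ => 0)
    (Sum.elim (fun x => if x ∈ X \ Y then w x else 0) fun _ => 0)
    (by
      rintro (x | x)
      · simp only [Sum.elim_inl]
        split_ifs
        exacts [hw x, le_rfl]
      · simp) q hq Finset.univ Finset.univ ((ν.trans σ).trans ν.symm) ((ν.trans τ).trans ν.symm)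
    (fun a => rfl) (fun a => rfl)
    (by
      rintro A D - - hAq hDq ⟨d₁, hd₁, -⟩ ⟨d₂, hd₂, -⟩
      rw [sum_sumElim_zero, sum_sumElim_zero, ← Finset.sum_filter, ← Finset.sum_filter]
      obtain ⟨B, hB⟩ : ∃ B, B = A.toLeft.filter (· ∈ Y \ X) := ⟨_, rfl⟩
      obtain ⟨C, hC⟩ : ∃ C, C = D.toLeft.filter (· ∈ X \ Y) := ⟨_, rfl⟩
      rw [← hB, ← hC]
      rcases B.eq_empty_or_nonempty with hemp | hne
      · rw [hemp, Finset.sum_empty]; exact Finset.sum_nonneg fun x _ => hw x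
      have hBc : B.card ≤ q := by
        rw [hB]; exact (Finset.card_filter_le _ _).trans (Finset.card_toLeft_le.trans hAq)
      have hCc : C.card ≤ q + 1 := by
        rw [hC]; exact (Finset.card_filter_le _ _).trans (Finset.card_toLeft_le.trans hDq)
      have hBY : B ⊆ Y \ X := fun v hv => by rw [hB] at hv; exact (Finset.mem_filter.1 hv).2
      have hDX : B.biUnion φ ⊆ X \ Y := Finset.biUnion_subset.2 fun v hv => (hφ1 v (hBY hv)).1
      have hsub : B.biUnion φ ⊆ C ∪ B.biUnion ρ := by
        intro x hx
        have hxXY := hDX hx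
        obtain ⟨v, hv, hxv⟩ := Finset.mem_biUnion.1 hx
        have hvA : Sum.inl v ∈ A := by
          rw [hB] at hv; exact Finset.mem_toLeft.1 (Finset.mem_filter.1 hv).1
        rw [Finset.mem_union, hC, Finset.mem_filter, Finset.mem_toLeft]
        rcases hR v (hBY hv) x hxv with h | h | h
        · left
          have := hd₁ _ hvA
          rw [← this.2, h] at this
          exact ⟨this.1, hxXY⟩
        · left
          have := hd₂ _ hvA
          rw [← this.2, h] at this
          exact ⟨this.1, hxXY⟩
        · exact Or.inr (Finset.mem_biUnion.2 ⟨v, hv, Finset.mem_filter.2 ⟨hxv, h⟩⟩)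
      have e1 : (X \ B.biUnion φ ∪ B) \ X = B := by
        ext x; have := @hBY x; clear * - this; grind
      have e2 : X \ (X \ B.biUnion φ ∪ B) = B.biUnion φ := by
        ext x; have := @hBY x; have h2 := @hDX x; clear * - this h2; grind
      have hT := H _ ⟨hφ3 B hBY, by rw [e1]; exact hBc, by
        rw [e2]; simp only [ConstraintKind.maxDelete]
        have g1 := (Finset.card_le_card hsub).trans (Finset.card_union_le _ _)
        have g2 := Finset.card_biUnion_le_card_mul B ρ k fun v _ => hρc v
        have g3 := Nat.mul_le_mul_right k hBc
        have g4 : (k + 2) * q - q + 1 = q * k + q + 1 := by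
          rw [show (k + 2) * q = (q * k + q) + q by ring, Nat.add_sub_cancel]
        omega⟩
      rw [e1, e2] at hT
      have g1 := Finset.sum_le_sum_of_subset_of_nonneg (f := w) hsub fun x _ _ => hw x
      have g2 := sum_union_le w hw C (B.biUnion ρ)
      have g3 := sum_biUnion_le w hw B ρ
      have h1 : (1 : ℝ) ≤ B.card := by exact_mod_cast hne.card_pos
      rw [Finset.sum_sub_distrib, Finset.sum_sub_distrib, Finset.sum_const, nsmul_eq_mul]
      nlinarith)
  have hu : (Finset.univ : Finset (Fin n ⊕ Fin n)).toLeft = Finset.univ := by ext; simp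
  rw [sum_sumElim_zero, sum_sumElim_zero, hu, ← Finset.sum_filter, ← Finset.sum_filter,
    Finset.filter_univ_mem, Finset.filter_univ_mem, Finset.sum_sub_distrib,
    Finset.sum_sub_distrib, Finset.sum_const, nsmul_eq_mul] at key
  have h1 : ((Y \ X).card : ℝ) ≤ n := by
    exact_mod_cast (Finset.card_le_univ _).trans (Fintype.card_fin n).le
  push_cast
  nlinarith

/-- A local optimum for a modular function, up to an additive slack `η`. -/
theorem ConstraintKind.Holds.sum_le_of_local_opt {n p q : ℕ} (hp : 2 ≤ p) (hq : 1 ≤ q)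
    {I : Set (Finset (Fin n))} {κ : ConstraintKind} (hI : κ.Holds p I) {X Y : Finset (Fin n)}
    (hX : X ∈ I) (hY : Y ∈ I) (w : Fin n → ℝ) (hw : ∀ x, 0 ≤ w x) (η : ℝ) (hη : 0 ≤ η)
    (H : ∀ T ∈ κ.reachable p q I X, ∑ x ∈ T \ X, w x ≤ ∑ x ∈ X \ T, w x + η) :
    ∑ x ∈ Y \ X, w x ≤ ((p : ℝ) - 1 + 1 / (q : ℝ)) * ∑ x ∈ X \ Y, w x + n * η := by
  cases κ with
  | matroidIntersection => exact sum_le_of_local_opt_matroidIntersection hp hq hI hX hY w hw η hη H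
  | exchangeSystem => exact sum_le_of_local_opt_exchangeSystem hp hq hI hX hY w hw η hη H

/-! ### Analysis of the objective -/

section Analysis

variable {n : ℕ} {u : EuclideanSpace ℝ (Fin n) → ℝ}

theorem eq_zero_of_supp_subset {w : EuclideanSpace ℝ (Fin n)} {X : Finset (Fin n)}
    (hw : supp w ⊆ X) {i : Fin n} (hi : i ∉ X) : w i = 0 := by
  by_contra h
  exact hi (hw (Finset.mem_filter.2 ⟨Finset.mem_univ _, h⟩))

theorem supp_subset_of_eq_zero {w : EuclideanSpace ℝ (Fin n)} {X : Finset (Fin n)}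
    (hw : ∀ i ∉ X, w i = 0) : supp w ⊆ X := by
  intro i hi
  by_contra h
  exact (Finset.mem_filter.1 hi).2 (hw i h)

theorem zero_mem_sparsePairs {w : EuclideanSpace ℝ (Fin n)} {X : Finset (Fin n)} {s : ℕ}
    (hw : supp w ⊆ X) (hX : X.card ≤ s) : (0, w) ∈ sparsePairs n s := by
  have h1 : supp (0 : EuclideanSpace ℝ (Fin n)) = ∅ := by simp [supp]
  have h2 : supp (0 - w) = supp w := by simp [supp]
  have h3 := (Finset.card_le_card hw).trans hX
  refine ⟨?_, h3, ?_⟩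
  · simp [h1]
  · change (supp (0 - w)).card ≤ s
    rw [h2]; exact h3

theorem inner_eq_sum_of_supp (v : EuclideanSpace ℝ (Fin n)) {w : EuclideanSpace ℝ (Fin n)}
    {X : Finset (Fin n)} (hw : supp w ⊆ X) : inner ℝ v w = ∑ i ∈ X, v i * w i := by
  rw [PiLp.inner_apply, ← Finset.sum_subset (Finset.subset_univ X)]
  · exact Finset.sum_congr rfl fun i _ => by simp [mul_comm]
  · intro i _ hi
    simp [eq_zero_of_supp_subset hw hi]

theorem norm_sq_eq_sum_of_supp {w : EuclideanSpace ℝ (Fin n)} {X : Finset (Fin n)}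
    (hw : supp w ⊆ X) : ‖w‖ ^ 2 = ∑ i ∈ X, w i ^ 2 := by
  rw [← real_inner_self_eq_norm_sq, inner_eq_sum_of_supp w hw]
  exact Finset.sum_congr rfl fun i _ => by ring

/-- Coordinatewise completion of the square at the pair `(0, w)`. -/
theorem RestrictedStronglyConcave.le_add_sum {m : ℝ} (hm : 0 < m) {s : ℕ}
    (h : RestrictedStronglyConcave u (sparsePairs n s) m) {w : EuclideanSpace ℝ (Fin n)}
    {X : Finset (Fin n)} (hw : supp w ⊆ X) (hX : X.card ≤ s) :
    u w ≤ u 0 + (∑ i ∈ X, gradient u 0 i ^ 2) / (2 * m) := by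
  have h1 := h 0 w (zero_mem_sparsePairs hw hX)
  rw [sub_zero, inner_eq_sum_of_supp _ hw, norm_sq_eq_sum_of_supp hw] at h1
  have h2 : ∑ i ∈ X, (gradient u 0 i * w i - m / 2 * w i ^ 2) ≤
      ∑ i ∈ X, gradient u 0 i ^ 2 / (2 * m) := by
    refine Finset.sum_le_sum fun i _ => ?_
    rw [le_div_iff₀ (by positivity)]
    nlinarith [sq_nonneg (gradient u 0 i - m * w i)]
  rw [Finset.sum_sub_distrib, ← Finset.mul_sum, ← Finset.sum_div] at h2
  linarith

/-- The witness `∇u(0) / M`, restricted to `X`, maximizes the quadratic lower bound. -/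
theorem RestrictedSmooth.exists_add_sum_le {M : ℝ} (hM : 0 < M) {s : ℕ}
    (h : RestrictedSmooth u (sparsePairs n s) M) {X : Finset (Fin n)} (hX : X.card ≤ s) :
    ∃ w, supp w ⊆ X ∧ u 0 + (∑ i ∈ X, gradient u 0 i ^ 2) / (2 * M) ≤ u w := by
  let w : EuclideanSpace ℝ (Fin n) :=
    WithLp.toLp 2 fun i => if i ∈ X then gradient u 0 i / M else 0
  have hwi : ∀ i, w i = if i ∈ X then gradient u 0 i / M else 0 := fun i => rfl
  have hw : supp w ⊆ X := supp_subset_of_eq_zero fun i hi => by rw [hwi, if_neg hi]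
  refine ⟨w, hw, ?_⟩
  have h1 := h 0 w (zero_mem_sparsePairs hw hX)
  rw [sub_zero, inner_eq_sum_of_supp _ hw, norm_sq_eq_sum_of_supp hw] at h1
  have h2 : ∑ i ∈ X, (gradient u 0 i * w i - M / 2 * w i ^ 2) =
      ∑ i ∈ X, gradient u 0 i ^ 2 / (2 * M) := by
    refine Finset.sum_congr rfl fun i hi => ?_
    rw [hwi, if_pos hi]
    field_simp
    ring
  rw [Finset.sum_sub_distrib, ← Finset.mul_sum, ← Finset.sum_div] at h2
  linarith

/-- Outside radius `2‖∇u(0)‖ / m` the quadratic term outweighs the linear one and `u w ≤ u 0`, so a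
compact set suffices. -/
theorem RestrictedStronglyConcave.isGreatest_sparseValue (hu : Continuous u) {m : ℝ} (hm : 0 < m)
    {s : ℕ} (h : RestrictedStronglyConcave u (sparsePairs n s) m)
    {X : Finset (Fin n)} (hX : X.card ≤ s) : IsGreatest (valuesOn u X) (sparseValue u X) := by
  have hclosed : IsClosed {w : EuclideanSpace ℝ (Fin n) | supp w ⊆ X} := by
    have : {w : EuclideanSpace ℝ (Fin n) | supp w ⊆ X} = ⋂ i ∈ (Xᶜ : Finset (Fin n)),
        {w | w i = 0} := by
      ext w
      simp only [Set.mem_ofPred_eq, Set.mem_iInter, Finset.mem_compl]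
      exact ⟨fun hw i hi => eq_zero_of_supp_subset hw hi, supp_subset_of_eq_zero⟩
    rw [this]
    exact isClosed_biInter fun i _ => isClosed_eq (by fun_prop) continuous_const
  have hsupp0 : supp (0 : EuclideanSpace ℝ (Fin n)) ⊆ X := by simp [supp]
  obtain ⟨w₀, ⟨-, hw₀⟩, hmax⟩ := ((isCompact_closedBall (0 : EuclideanSpace ℝ (Fin n))
    (2 * ‖gradient u 0‖ / m)).inter_right hclosed).exists_isMaxOn
    ⟨0, Metric.mem_closedBall_self (by positivity), hsupp0⟩ hu.continuousOn
  have hge : ∀ w, supp w ⊆ X → u w ≤ u w₀ := by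
    intro w hw
    by_cases hball : w ∈ Metric.closedBall (0 : EuclideanSpace ℝ (Fin n))
        (2 * ‖gradient u 0‖ / m)
    · exact hmax ⟨hball, hw⟩
    · have h0 : u 0 ≤ u w₀ := hmax ⟨Metric.mem_closedBall_self (by positivity), hsupp0⟩
      refine le_trans ?_ h0
      have h1 := h 0 w (zero_mem_sparsePairs hw hX)
      have h2 := real_inner_le_norm (gradient u 0) w
      rw [mem_closedBall_zero_iff, not_le, div_lt_iff₀ hm] at hball
      rw [sub_zero] at h1
      nlinarith [norm_nonneg w]
  have hgr : IsGreatest (valuesOn u X) (u w₀) :=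
    ⟨⟨w₀, hw₀, rfl⟩, by rintro _ ⟨w, hw, rfl⟩; exact hge w hw⟩
  have : sparseValue u X = u w₀ := hgr.csSup_eq
  rwa [this]

theorem sparseValue_le (hu : Continuous u) {m : ℝ} (hm : 0 < m) {s : ℕ}
    (h : RestrictedStronglyConcave u (sparsePairs n s) m) {X : Finset (Fin n)} (hX : X.card ≤ s) :
    sparseValue u X ≤ u 0 + (∑ i ∈ X, gradient u 0 i ^ 2) / (2 * m) := by
  obtain ⟨w, hw, hwv⟩ := (h.isGreatest_sparseValue hu hm hX).1
  rw [← hwv]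
  exact h.le_add_sum hm hw hX

theorem le_sparseValue (hu : Continuous u) {m M : ℝ} (hm : 0 < m) (hM : 0 < M) {s : ℕ}
    (h : RestrictedStronglyConcave u (sparsePairs n s) m)
    (h' : RestrictedSmooth u (sparsePairs n s) M) {X : Finset (Fin n)} (hX : X.card ≤ s) :
    u 0 + (∑ i ∈ X, gradient u 0 i ^ 2) / (2 * M) ≤ sparseValue u X := by
  obtain ⟨w, hw, hwv⟩ := h'.exists_add_sum_le hM hX
  exact hwv.trans ((h.isGreatest_sparseValue hu hm hX).2 ⟨w, hw, rfl⟩)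

/-- A unit vector tests both conditions at every level. The mixed cases `m₁ ≤ Mₛ` and `mₛ ≤ M₁` take
care of the constant `f(∅)`. -/
theorem concavity_le_smoothness {m M : ℝ} {s t : ℕ} (hs : 1 ≤ s) (ht : 1 ≤ t) (i : Fin n)
    (h : RestrictedStronglyConcave u (sparsePairs n s) m)
    (h' : RestrictedSmooth u (sparsePairs n t) M) : m ≤ M := by
  have hw : supp (EuclideanSpace.single i (1 : ℝ)) ⊆ {i} := supp_subset_of_eq_zero fun j hj => by
    rw [Finset.mem_singleton] at hj
    simp [hj]
  have h1 := h 0 _ (zero_mem_sparsePairs hw (by simpa using hs))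
  have h2 := h' 0 _ (zero_mem_sparsePairs hw (by simpa using ht))
  rw [sub_zero, PiLp.norm_single] at h1 h2
  norm_num at h1 h2
  linarith

end Analysis

/-! ### Counting -/

theorem card_filter_card_le (n a : ℕ) :
    (Finset.univ.filter fun U : Finset (Fin n) => U.card ≤ a).card ≤ (n + 1) ^ a := by
  induction a with
  | zero =>
    rw [pow_zero, Finset.card_le_one]
    intro U hU V hV
    simp only [Finset.mem_filter, Nat.le_zero, Finset.card_eq_zero] at hU hV
    rw [hU.2, hV.2]
  | succ a ih =>
    have hsub : (Finset.univ.filter fun U : Finset (Fin n) => U.card ≤ a + 1) ⊆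
        ((Finset.univ.filter fun U : Finset (Fin n) => U.card ≤ a) ×ˢ
          (Finset.univ : Finset (Option (Fin n)))).image fun z => z.1 ∪ z.2.toFinset := by
      intro U hU
      have hU' := (Finset.mem_filter.1 hU).2
      refine Finset.mem_image.2 ?_
      rcases U.eq_empty_or_nonempty with rfl | ⟨x, hx⟩
      · exact ⟨(∅, none), by simp, by simp⟩
      · refine ⟨(U.erase x, some x), ?_, ?_⟩
        · simp only [Finset.mem_product, Finset.mem_filter, Finset.mem_univ, true_and, and_true]
          rw [Finset.card_erase_of_mem hx]; omega
        · ext y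
          by_cases h : y = x <;> simp [h, hx]
    refine (Finset.card_le_card hsub).trans (Finset.card_image_le.trans ?_)
    rw [Finset.card_product, Finset.card_univ, Fintype.card_option, Fintype.card_fin, pow_succ]
    exact Nat.mul_le_mul_right _ ih

/-- A set `T` is recovered from `X` and the pair `(T \ X, X \ T)`. -/
theorem ncard_reachable_le {n : ℕ} (κ : ConstraintKind) (p q : ℕ) (I : Set (Finset (Fin n)))
    (X : Finset (Fin n)) :
    (κ.reachable p q I X).ncard ≤ (n + 1) ^ (κ.maxInsert q + κ.maxDelete p q) := by
  let P : Finset (Finset (Fin n) × Finset (Fin n)) :=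
    (Finset.univ.filter fun U => U.card ≤ κ.maxInsert q) ×ˢ
      (Finset.univ.filter fun U => U.card ≤ κ.maxDelete p q)
  have h1 : (κ.reachable p q I X).ncard ≤ (P : Set (Finset (Fin n) × Finset (Fin n))).ncard := by
    refine Set.ncard_le_ncard_of_injOn (fun T => (T \ X, X \ T)) ?_ ?_ P.finite_toSet
    · intro T hT
      simp only [P, Finset.mem_coe, Finset.mem_product, Finset.mem_filter, Finset.mem_univ,
        true_and]
      exact hT.2
    · intro T _ T' _ h
      rw [Prod.mk.injEq] at h
      ext x
      have e1 := Finset.ext_iff.1 h.1 x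
      have e2 := Finset.ext_iff.1 h.2 x
      simp only [Finset.mem_sdiff] at e1 e2
      tauto
  rw [Set.ncard_coe_finset, Finset.card_product] at h1
  rw [pow_add]
  exact h1.trans (Nat.mul_le_mul (card_filter_card_le _ _) (card_filter_card_le _ _))

/-! ### The local search -/

section LocalSearch

variable {n : ℕ} {I : Set (Finset (Fin n))} {nbhd : Finset (Fin n) → Set (Finset (Fin n))}
  {g : Finset (Fin n) → ℝ} {δ : ℝ} {k : ℕ} {X : Finset (Fin n)}

theorem ConstraintKind.Holds.isIndependenceSystem {κ : ConstraintKind} {p : ℕ}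
    (h : κ.Holds p I) : IsIndependenceSystem I := by
  cases κ with
  | matroidIntersection =>
    obtain ⟨M, -, hM⟩ := h
    refine ⟨(hM ∅).2 fun i => by simp, fun X Y hXY hY => (hM X).2 fun i => ?_⟩
    exact ((hM Y).1 hY i).subset (by exact_mod_cast hXY)
  | exchangeSystem => exact h.1

theorem LocalSearchState.mem (hnb : ∀ X, nbhd X ⊆ I) (h : LocalSearchState I nbhd g δ k X) :
    X ∈ I := by
  cases h with
  | init v X hX hv hmax => exact hX
  | step k X Y hX hY himp => exact hnb X hY

/-- Strictness after the first move lets `LocalSearchState.le_log` cancel `g {v}` knowing only `0 ≤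
g {v}`. -/
theorem LocalSearchState.growth (hg : Monotone g) (hδ : 0 < δ)
    (h : LocalSearchState I nbhd g δ k X) :
    ∃ v : Fin n, (∀ w, {w} ∈ I → g {w} ≤ g {v}) ∧ (1 + δ) ^ k * g {v} ≤ g X ∧
      (0 < k → (1 + δ) ^ k * g {v} < g X) := by
  induction h with
  | init v X hX hv hmax =>
    refine ⟨v, hmax, ?_, fun h => absurd h (lt_irrefl _)⟩
    rw [pow_zero, one_mul]
    exact hg (Finset.singleton_subset_iff.2 hv)
  | step k X Y hX hY himp ih =>
    obtain ⟨v, hv, hle, -⟩ := ih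
    have : (1 + δ) ^ (k + 1) * g {v} < g Y := by
      have := mul_le_mul_of_nonneg_left hle (by linarith : 0 ≤ 1 + δ)
      rw [pow_succ']
      linarith
    exact ⟨v, hv, this.le, fun _ => this⟩

theorem LocalSearchState.le_log (hnb : ∀ X, nbhd X ⊆ I)
    (hg : Monotone g) (hδ : 0 < δ) {s : ℕ} (hs1 : 1 ≤ s)
    (hbound : ∀ v : Fin n, (∀ w, {w} ∈ I → g {w} ≤ g {v}) → 0 ≤ g {v} ∧ ∀ X ∈ I, g X ≤ s * g {v})
    (h : LocalSearchState I nbhd g δ k X) : (k : ℝ) ≤ Real.log s / Real.log (1 + δ) := by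
  have hs : (1 : ℝ) ≤ s := by exact_mod_cast hs1
  have hlog : 0 < Real.log (1 + δ) := Real.log_pos (by linarith)
  rcases Nat.eq_zero_or_pos k with rfl | hk
  · rw [Nat.cast_zero]
    exact div_nonneg (Real.log_nonneg hs) hlog.le
  obtain ⟨v, hv, -, hlt⟩ := h.growth hg hδ
  obtain ⟨h0, hX⟩ := hbound v hv
  have h1 := (hlt hk).trans_le (hX X (h.mem hnb))
  have h2 := lt_of_mul_lt_mul_right h1 h0
  rw [le_div_iff₀ hlog, ← Real.log_pow]
  exact Real.log_le_log (by positivity) h2.le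

theorem exists_localSearchOutput {v : Fin n} (hv : {v} ∈ I)
    (hbound : ∃ B : ℝ, ∀ k X, LocalSearchState I nbhd g δ k X → (k : ℝ) ≤ B) :
    ∃ k X, LocalSearchOutput I nbhd g δ k X := by
  classical
  by_contra hcon
  push Not at hcon
  have hall : ∀ k, ∃ X, LocalSearchState I nbhd g δ k X := by
    intro k
    induction k with
    | zero =>
      obtain ⟨v₀, hv₀, hmax⟩ := (Finset.univ.filter fun v : Fin n => {v} ∈ I).exists_max_image
        (fun v => g {v}) ⟨v, by simpa using hv⟩
      exact ⟨{v₀}, .init v₀ _ (Finset.mem_filter.1 hv₀).2 (Finset.mem_singleton_self _)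
        fun w hw => hmax w (by simpa using hw)⟩
    | succ k ih =>
      obtain ⟨X, hX⟩ := ih
      by_contra hno
      refine hcon k X ⟨hX, fun Y hY => ?_⟩
      by_contra hlt
      exact hno ⟨Y, .step k X Y hX hY (not_le.1 hlt)⟩
  obtain ⟨B, hB⟩ := hbound
  obtain ⟨k, hk⟩ := exists_nat_gt B
  obtain ⟨X, hX⟩ := hall k
  exact absurd (hB k X hX) (not_le.2 hk)

end LocalSearch

/-! ### The modular approximation. -/

section Modular

variable {n : ℕ} {f : Finset (Fin n) → ℝ}

theorem modularApprox_singleton (v : Fin n) : modularApprox f {v} = f {v} := by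
  simp [modularApprox]

theorem modularApprox_monotone (hf : ∀ x, f ∅ ≤ f {x}) : Monotone (modularApprox f) := by
  intro X Y h
  unfold modularApprox
  have := Finset.sum_le_sum_of_subset_of_nonneg (f := fun x => f {x} - f ∅) h
    fun x _ _ => sub_nonneg.2 (hf x)
  linarith

theorem modularApprox_le_mul (hf0 : 0 ≤ f ∅) (hf : ∀ x, f ∅ ≤ f {x}) {I : Set (Finset (Fin n))}
    (hI : IsIndependenceSystem I) {s : ℕ} (hs1 : 1 ≤ s) (hs : ∀ X ∈ I, X.card ≤ s) (v : Fin n)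
    (hv : ∀ w, {w} ∈ I → modularApprox f {w} ≤ modularApprox f {v}) {X : Finset (Fin n)}
    (hX : X ∈ I) : modularApprox f X ≤ s * modularApprox f {v} := by
  rw [modularApprox_singleton]
  have hb : ∀ x ∈ X, f {x} - f ∅ ≤ f {v} - f ∅ := fun x hx => by
    have := hv x (hI.2 _ X (Finset.singleton_subset_iff.2 hx) hX)
    rw [modularApprox_singleton, modularApprox_singleton] at this
    linarith
  have h1 := Finset.sum_le_sum hb
  rw [Finset.sum_const, nsmul_eq_mul] at h1
  have h2 : (X.card : ℝ) ≤ s := by exact_mod_cast hs X hX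
  have h3 : (1 : ℝ) ≤ s := by exact_mod_cast hs1
  have h4 := mul_le_mul_of_nonneg_right h2 (sub_nonneg.2 (hf v))
  unfold modularApprox
  nlinarith

/-- The slack is `η = δ f̃(X)`, so `n η ≤ ε f̃(X)`. The constant `f(∅)` and the weight of `X ∩ Y`
occur on both sides and are absorbed because `p - 1 + 1/q ≥ 1`. -/
theorem modularApprox_le_of_local_opt (hf0 : 0 ≤ f ∅) (hf : ∀ x, f ∅ ≤ f {x}) {p q : ℕ}
    (hp : 2 ≤ p) (hq : 1 ≤ q) {I : Set (Finset (Fin n))} {κ : ConstraintKind} (hI : κ.Holds p I)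
    {X Y : Finset (Fin n)} (hX : X ∈ I) (hY : Y ∈ I) {ε δ : ℝ} (hδ : 0 < δ) (hδε : δ * n ≤ ε)
    (H : ∀ T ∈ κ.reachable p q I X, modularApprox f T ≤ (1 + δ) * modularApprox f X) :
    modularApprox f Y ≤ ((p : ℝ) - 1 + 1 / (q : ℝ) + ε) * modularApprox f X := by
  have hw : ∀ x, 0 ≤ f {x} - f ∅ := fun x => sub_nonneg.2 (hf x)
  have hsplit : ∀ S T : Finset (Fin n), modularApprox f S =
      f ∅ + ∑ x ∈ S ∩ T, (f {x} - f ∅) + ∑ x ∈ S \ T, (f {x} - f ∅) := fun S T => by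
    rw [modularApprox, add_assoc, Finset.sum_inter_add_sum_sdiff]
  have hg0 : 0 ≤ modularApprox f X := add_nonneg hf0 (Finset.sum_nonneg fun x _ => hw x)
  have key := hI.sum_le_of_local_opt hp hq hX hY (fun x => f {x} - f ∅) hw
    (δ * modularApprox f X) (by positivity) (fun T hT => by
      have h1 := H T hT
      have h2 := hsplit T X
      have h3 := hsplit X T
      rw [Finset.inter_comm] at h3
      linarith)
  have h2 := hsplit Y X
  have h3 := hsplit X Y
  rw [Finset.inter_comm] at h3
  have hc : (1 : ℝ) ≤ (p : ℝ) - 1 + 1 / (q : ℝ) := by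
    have : (2 : ℝ) ≤ p := by exact_mod_cast hp
    have : 0 ≤ 1 / (q : ℝ) := by positivity
    linarith
  set c : ℝ := (p : ℝ) - 1 + 1 / (q : ℝ)
  have h4 : 0 ≤ ∑ x ∈ Y ∩ X, (f {x} - f ∅) := Finset.sum_nonneg fun x _ => hw x
  have h5 := mul_le_mul_of_nonneg_right hδε hg0
  have h6 := mul_le_mul_of_nonneg_right hc (add_nonneg hf0 h4)
  have h7 : c * modularApprox f X = c * (f ∅ + ∑ x ∈ Y ∩ X, (f {x} - f ∅)) +
      c * ∑ x ∈ X \ Y, (f {x} - f ∅) := by rw [h3]; ring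
  linarith

end Modular

end SparseOpt

/-! ### Combining the local search with the bounds on `f`. -/

open SparseOpt

theorem mainTheorem9 (n : ℕ) (u : EuclideanSpace ℝ (Fin n) → ℝ)
    (hu : ContDiff ℝ 1 u) (hu0 : 0 ≤ u 0)
    (p q : ℕ) (hp : 2 ≤ p) (hq : 1 ≤ q)
    (I : Set (Finset (Fin n))) (κ : ConstraintKind) (hI : κ.Holds p I)
    (s : ℕ) (hs : IsGreatest (Finset.card '' I) s) (hs1 : 1 ≤ s)
    (m₁ M₁ mₛ Mₛ : ℝ) (hm₁ : 0 < m₁) (hmₛ : 0 < mₛ)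
    (hconc₁ : RestrictedStronglyConcave u (sparsePairs n 1) m₁)
    (hsmooth₁ : RestrictedSmooth u (sparsePairs n 1) M₁)
    (hconcₛ : RestrictedStronglyConcave u (sparsePairs n s) mₛ)
    (hsmoothₛ : RestrictedSmooth u (sparsePairs n s) Mₛ)
    (ε δ : ℝ) (hε : 0 < ε) (hδ : 0 < δ) (hδε : δ * n ≤ ε) :
    -- the objective `f(X) = max_{supp(w) ⊆ X} u(w)` is an attained maximum on feasible sets
    (∀ X ∈ I, IsGreatest (valuesOn u X) (sparseValue u X)) ∧
    -- every execution stops: bounds on the number of iterations and of candidates for a move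
    (∀ k X, LocalSearchState I (κ.reachable p q I) (modularApprox (sparseValue u)) δ k X →
      (k : ℝ) ≤ Real.log s / Real.log (1 + δ) ∧
      (κ.reachable p q I X).ncard ≤ (n + 1) ^ (κ.maxInsert q + κ.maxDelete p q)) ∧
    -- some output is returned
    (∃ k X, LocalSearchOutput I (κ.reachable p q I) (modularApprox (sparseValue u)) δ k X) ∧
    -- every output is feasible and has the claimed approximation ratio
    (∀ k X, LocalSearchOutput I (κ.reachable p q I) (modularApprox (sparseValue u)) δ k X →
      X ∈ I ∧
      ∀ Y ∈ I, (1 / ((p : ℝ) - 1 + 1 / (q : ℝ)) * (m₁ * mₛ / (M₁ * Mₛ)) - ε) * sparseValue u Y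
        ≤ sparseValue u X) := by
  have hcont := hu.continuous
  have hsys := hI.isIndependenceSystem
  have hcard : ∀ X ∈ I, X.card ≤ s := fun X hX => hs.2 ⟨X, hX, rfl⟩
  obtain ⟨Xₛ, hXₛ, hXs⟩ := hs.1
  obtain ⟨v, hvX⟩ : Xₛ.Nonempty := Finset.card_pos.1 (by omega)
  have hv : {v} ∈ I := hsys.2 _ _ (Finset.singleton_subset_iff.2 hvX) hXₛ
  have hm₁M₁ := concavity_le_smoothness le_rfl le_rfl v hconc₁ hsmooth₁
  have hm₁Mₛ := concavity_le_smoothness le_rfl hs1 v hconc₁ hsmoothₛ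
  have hmₛM₁ := concavity_le_smoothness hs1 le_rfl v hconcₛ hsmooth₁
  have hmₛMₛ := concavity_le_smoothness hs1 hs1 v hconcₛ hsmoothₛ
  have hM₁ : 0 < M₁ := by linarith
  have hMₛ : 0 < Mₛ := by linarith
  have hfe : sparseValue u ∅ = u 0 := by
    have h1 := sparseValue_le hcont hm₁ hconc₁ (X := ∅) (by simp)
    have h2 := le_sparseValue hcont hm₁ hM₁ hconc₁ hsmooth₁ (X := ∅) (by simp)
    simp only [Finset.sum_empty, zero_div, add_zero] at h1 h2
    exact le_antisymm h1 h2
  have hlow : ∀ x, gradient u 0 x ^ 2 / (2 * M₁) ≤ sparseValue u {x} - sparseValue u ∅ := by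
    intro x
    have := le_sparseValue hcont hm₁ hM₁ hconc₁ hsmooth₁ (X := {x}) (by simp)
    rw [Finset.sum_singleton] at this
    linarith
  have hupp : ∀ x, sparseValue u {x} - sparseValue u ∅ ≤ gradient u 0 x ^ 2 / (2 * m₁) := by
    intro x
    have := sparseValue_le hcont hm₁ hconc₁ (X := {x}) (by simp)
    rw [Finset.sum_singleton] at this
    linarith
  have hf0 : 0 ≤ sparseValue u ∅ := hfe ▸ hu0
  have hf : ∀ x, sparseValue u ∅ ≤ sparseValue u {x} := fun x => by
    have h1 := hlow x
    have h2 : 0 ≤ gradient u 0 x ^ 2 / (2 * M₁) := by positivity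
    linarith
  have hnb : ∀ X, κ.reachable p q I X ⊆ I := fun X T hT => hT.1
  have hlog : ∀ k X, LocalSearchState I (κ.reachable p q I) (modularApprox (sparseValue u)) δ k X →
      (k : ℝ) ≤ Real.log s / Real.log (1 + δ) := fun k X h =>
    h.le_log hnb (modularApprox_monotone hf) hδ hs1 fun v hv =>
      ⟨by rw [modularApprox_singleton]; linarith [hf v],
        fun X hX => modularApprox_le_mul hf0 hf hsys hs1 hcard v hv hX⟩
  refine ⟨fun X hX => hconcₛ.isGreatest_sparseValue hcont hmₛ (hcard X hX),
    fun k X h => ⟨hlog k X h, ncard_reachable_le κ p q I X⟩,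
    exists_localSearchOutput hv ⟨_, hlog⟩, fun k X hX => ⟨hX.1.mem hnb, fun Y hY => ?_⟩⟩
  have hXI := hX.1.mem hnb
  have key := modularApprox_le_of_local_opt hf0 hf hp hq hI hXI hY hδ hδε hX.2
  have hc : (1 : ℝ) ≤ (p : ℝ) - 1 + 1 / (q : ℝ) := by
    have : (2 : ℝ) ≤ p := by exact_mod_cast hp
    have : 0 ≤ 1 / (q : ℝ) := by positivity
    linarith
  set c : ℝ := (p : ℝ) - 1 + 1 / (q : ℝ)
  have hXlow : m₁ * modularApprox (sparseValue u) X ≤ Mₛ * sparseValue u X := by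
    have h1 := le_sparseValue hcont hmₛ hMₛ hconcₛ hsmoothₛ (hcard X hXI)
    have h2 := Finset.sum_le_sum fun x (_ : x ∈ X) => hupp x
    rw [← Finset.sum_div, le_div_iff₀ (by positivity)] at h2
    rw [← hfe, ← le_sub_iff_add_le', div_le_iff₀ (by positivity)] at h1
    unfold modularApprox
    nlinarith [mul_le_mul_of_nonneg_right hm₁Mₛ hf0]
  have hYupp : mₛ * sparseValue u Y ≤ M₁ * modularApprox (sparseValue u) Y := by
    have h1 := sparseValue_le hcont hmₛ hconcₛ (hcard Y hY)
    have h2 := Finset.sum_le_sum fun x (_ : x ∈ Y) => hlow x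
    rw [← Finset.sum_div, div_le_iff₀ (by positivity)] at h2
    rw [← hfe, ← sub_le_iff_le_add', le_div_iff₀ (by positivity)] at h1
    unfold modularApprox
    nlinarith [mul_le_mul_of_nonneg_right hmₛM₁ hf0]
  have hY0 : 0 ≤ sparseValue u Y := by
    have h1 := le_sparseValue hcont hmₛ hMₛ hconcₛ hsmoothₛ (hcard Y hY)
    have h2 : 0 ≤ (∑ i ∈ Y, gradient u 0 i ^ 2) / (2 * Mₛ) := by positivity
    linarith
  have hcε : 0 < c + ε := by linarith
  obtain ⟨θ, hθ⟩ : ∃ θ, θ = m₁ * mₛ / (M₁ * Mₛ) := ⟨_, rfl⟩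
  have hθ0 : 0 ≤ θ := by rw [hθ]; positivity
  have hθ1 : θ ≤ 1 := by
    rw [hθ, div_le_one (by positivity)]
    exact mul_le_mul hm₁M₁ hmₛMₛ hmₛ.le hM₁.le
  have hmain : θ * sparseValue u Y ≤ (c + ε) * sparseValue u X := by
    rw [hθ, div_mul_eq_mul_div, div_le_iff₀ (by positivity)]
    calc m₁ * mₛ * sparseValue u Y = m₁ * (mₛ * sparseValue u Y) := by ring
      _ ≤ m₁ * (M₁ * ((c + ε) * modularApprox (sparseValue u) X)) := by
        refine mul_le_mul_of_nonneg_left (hYupp.trans ?_) hm₁.le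
        exact mul_le_mul_of_nonneg_left key hM₁.le
      _ = M₁ * (c + ε) * (m₁ * modularApprox (sparseValue u) X) := by ring
      _ ≤ M₁ * (c + ε) * (Mₛ * sparseValue u X) :=
        mul_le_mul_of_nonneg_left hXlow (by positivity)
      _ = (c + ε) * sparseValue u X * (M₁ * Mₛ) := by ring
  -- The left side equals `θ + ε (θ / c - c - ε)`, and `θ / c ≤ 1 ≤ c`; this trades the divisor `c +
  -- ε` for a subtracted `ε`.
  have hcoef : (c + ε) * (1 / c * θ - ε) ≤ θ := by
    have hc0 : 0 < c := by linarith
    have e : (c + ε) * (1 / c * θ - ε) = θ + ε * (1 / c * θ) - (c + ε) * ε := by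
      field_simp
    have h1 : 1 / c * θ ≤ 1 := mul_le_one₀ (by rw [div_le_one hc0]; exact hc) hθ0 hθ1
    nlinarith
  rw [← hθ]
  refine le_of_mul_le_mul_left ?_ hcε
  rw [← mul_assoc]
  exact (mul_le_mul_of_nonneg_right hcoef hY0).trans hmain
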